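/- Let $k$ be an algebraically closed field of characteristic $0$, let $q\in k^\times$ not be a root of unity, and let $\mathfrak g$ be a finite-dimensional simple Lie algebra over $k$ with Cartan matrix $C=(a_{ij})_{1\le i,j\le n}$, where $a_{ij}=\langle\alpha_j,\alpha_i^\vee\rangle$ for simple roots $\alpha_1,\dots,\alpha_n$. Let $d_1,\dots,d_n$ be positive integers with $d_ia_{ij}=d_ja_{ji}$ for all $i,j$ and with $\sum_i d_i$ minimal, and put $q_i=q^{d_i}$. Let $U^{\ge 0}$ be the $k$-algebra with generators $E_i,K_i,K_i^{-1}$ ($1\le i\le n$) and relations $$K_iK_j=K_jK_i,\qquad K_iK_i^{-1}=K_i^{-1}K_i=1,\qquad K_iE_jK_i^{-1}=q_j^{a_{ji}}E_j,$$ $$\sum_{s=0}^{1-a_{ij}}(-1)^s\begin{bmatrix}1-a_{ij}\\ s\end{bmatrix}_{q_i}E_i^{1-a_{ij}-s}E_jE_i^s=0\quad(i\ne j),$$ with the symmetric Gaussian binomial coefficients built from $[m]_r=(r^m-r^{-m})/(r-r^{-1})$. It is a Hopf algebra with $\Delta E_i=E_i\otimes 1+K_i\otimes E_i$, $\Delta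 K_i=K_i\otimes K_i$, $\varepsilon(E_i)=0$, $\varepsilon(K_i)=1$, $S(E_i)=-K_i^{-1}E_i$, $S(K_i)=K_i^{-1}$, and its antipode is bijective. Let $\mathcal G(U^{\ge0})$ be the set of group-like elements of $U^{\ge 0}$, and $\mathcal G((U^{\ge0})^\circ)$ the set of group-like elements of its finite dual; the latter are algebra maps $\beta:U^{\ge0}\to k$. A (left-right) Yetter–Drinfel'd $U^{\ge0}$-module is a left module and right comodule $M$ with $h_{(1)}\cdot m_{(0)}\otimes h_{(2)}m_{(1)}=(h_{(2)}\cdot m)_{(0)}\otimes(h_{(2)}\cdot m)_{(1)}h_{(1)}$ for all $h\in U^{\ge0}$, $m\in M$. It is simple if it is nonzero and has no subspace, other than $0$ and $M$, that is both a submodule and a subcomodule. It is a weight module if $M=\bigoplus_{\sigma\in(k^\times)^n}M_{(\sigma)}$, where $M_{(\sigma)}=\{v\in M: K_i\cdot v=\sigma_iv\ \text{for all } i\}$. For $\beta\in\mathcal G((U^{\ge0})^\circ)$ and $g\in\mathcal G(U^{\ge0})$ let $(U^{\ge0})_\beta$ be the Yetter–Drinfel'd module $U^{\ge0}$ with coaction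 $\Delta$ and action $h\cdot_\beta a=\beta(h_{(2)})\,h_{(3)}\,a\,S^{-1}(h_{(1)})$, and let $(U^{\ge0})_{\beta,g}=U^{\ge0}\cdot_\beta g$ be its Yetter–Drinfel'd submodule generated by $g$. **Theorem.** 1. The map $\mathcal G((U^{\ge0})^\circ)\to(k^\times)^n$, $\beta\mapsto(\beta(K_1),\dots,\beta(K_n))$, is a bijection. 2. The map $\lambda=\sum_i t_i\alpha_i\mapsto K_\lambda=K_1^{t_1}\cdots K_n^{t_n}$ is a bijection from the root lattice $Q=\bigoplus_i\mathbb Z\alpha_i$ onto $\mathcal G(U^{\ge0})$. 3. The map $\Phi(\beta,g)=[(U^{\ge0})_{\beta,g}]$ is a bijection from $\mathcal G((U^{\ge0})^\circ)\times\mathcal G(U^{\ge0})$ onto the set $\mathcal E$ of isomorphism classes of those simple Yetter–Drinfel'd $U^{\ge0}$-modules that are weight modules. -/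

import Mathlib

open scoped TensorProduct

noncomputable section

namespace HalfQuantum

universe u v w

/-! ### Quantum integers -/

section QuantumIntegers

variable {k : Type u} [Field k]

/-- The quantum integer `[n]_r = (r ^ n - r ^ (-n)) / (r - r ^ (-1))`. -/
def qInt (r : k) (n : ℕ) : k := (r ^ n - (r ^ n)⁻¹) / (r - r⁻¹)

/-- The quantum factorial `[n]_r! = [n]_r [n-1]_r ⋯ [1]_r`. -/
def qFactorial (r : k) (n : ℕ) : k := ∏ m ∈ Finset.range n, qInt r (m + 1)

/-- The Gaussian binomial coefficient `[n]_r! / ([j]_r! [n-j]_r!)`, used for `j ≤ n`. -/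
def qBinom (r : k) (n j : ℕ) : k := qFactorial r n / (qFactorial r j * qFactorial r (n - j))

/-- `∑_{s=0}^{N} (-1)^s [N choose s]_r x^{N-s} y x^s`. -/
def serreSum {B : Type v} [Ring B] [Algebra k B] (r : k) (N : ℕ) (x y : B) : B :=
  ∑ s ∈ Finset.range (N + 1), ((-1) ^ s * qBinom r N s) • (x ^ (N - s) * y * x ^ s)

/-- Auxiliary: Gaussian binomials through the Pascal recursion. -/
def gb (r : k) : ℕ → ℕ → k
  | _, 0 => 1
  | 0, _ + 1 => 0
  | t + 1, s + 1 => r ^ (-(s + 1 : ℤ)) * gb r t (s + 1) + r ^ ((t : ℤ) - s) * gb r t s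

variable {r : k}

@[simp] theorem gb_zero_right (t : ℕ) : gb r t 0 = 1 := by cases t <;> rfl

theorem gb_succ (t s : ℕ) : gb r (t + 1) (s + 1) =
    r ^ (-(s + 1 : ℤ)) * gb r t (s + 1) + r ^ ((t : ℤ) - s) * gb r t s := rfl

theorem gb_eq_zero {t s : ℕ} (h : t < s) : gb r t s = 0 := by
  induction t generalizing s with
  | zero => cases s with
    | zero => omega
    | succ s => rfl
  | succ t ih => cases s with
    | zero => omega
    | succ s => rw [gb_succ, ih (by omega), ih (by omega)]; simp

theorem gb_succ' (hr : r ≠ 0) (t s : ℕ) : gb r (t + 1) (s + 1) =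
    r ^ (s + 1 : ℤ) * gb r t (s + 1) + r ^ ((s : ℤ) - t) * gb r t s := by
  induction t generalizing s with
  | zero => cases s with
    | zero => simp [gb]
    | succ s => simp [gb]
  | succ t ih =>
    cases s with
    | zero =>
      have h1 := gb_succ (r := r) (t + 1) 0
      have h2 := gb_succ (r := r) t 0
      rw [h1, ih 0]
      have h3 : r ^ ((0 : ℕ) + 1 : ℤ) * gb r t (0 + 1) + r ^ (((0 : ℕ) : ℤ) - t) *
          gb r t 0 = _ := (ih 0).symm.trans h2
      conv_rhs => rw [h3]
      simp only [gb_zero_right, mul_add, ← mul_assoc, ← zpow_add₀ hr, mul_one]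
      push_cast
      ring_nf
    | succ s =>
      rw [gb_succ (t + 1) (s + 1), ih (s + 1), ih s]
      have h1 : r ^ ((s + 1 : ℕ) + 1 : ℤ) * gb r t (s + 1 + 1) + r ^ (((s + 1 : ℕ) : ℤ) - t) *
          gb r t (s + 1) = _ := (ih (s + 1)).symm.trans (gb_succ t (s + 1))
      have h2 : r ^ (s + 1 : ℤ) * gb r t (s + 1) + r ^ ((s : ℤ) - t) * gb r t s = _ :=
        (ih s).symm.trans (gb_succ t s)
      conv_rhs => rw [h1, h2]
      simp only [mul_add, ← mul_assoc, ← zpow_add₀ hr]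
      push_cast
      ring_nf

theorem qInt_ne_zero (hr : r ≠ 0) (h : ∀ n : ℕ, 0 < n → r ^ n ≠ 1) {n : ℕ} (hn : 0 < n) :
    qInt r n ≠ 0 := by
  have key : ∀ m : ℕ, 0 < m → r ^ m - (r ^ m)⁻¹ ≠ 0 := by
    intro m hm h0
    have h1 : r ^ m ≠ 0 := pow_ne_zero _ hr
    apply h (m * 2) (by omega)
    rw [sub_eq_zero] at h0
    rw [pow_mul, sq]
    nth_rewrite 2 [h0]
    exact mul_inv_cancel₀ h1
  refine div_ne_zero (key n hn) ?_
  simpa using key 1 one_pos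

theorem qFactorial_ne_zero (hr : r ≠ 0) (h : ∀ n : ℕ, 0 < n → r ^ n ≠ 1) (n : ℕ) :
    qFactorial r n ≠ 0 :=
  Finset.prod_ne_zero_iff.mpr fun _ _ => qInt_ne_zero hr h (Nat.succ_pos _)

theorem qFactorial_succ (n : ℕ) : qFactorial r (n + 1) = qFactorial r n * qInt r (n + 1) :=
  Finset.prod_range_succ _ _

theorem qInt_split (hr : r ≠ 0) (a b : ℕ) : qInt r (a + b) =
    r ^ (-(b : ℤ)) * qInt r a + r ^ (a : ℤ) * qInt r b := by
  simp only [qInt, zpow_neg, zpow_natCast, pow_add, mul_inv, mul_div_assoc']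
  rw [← add_div]
  congr 1
  have h1 : r ^ a ≠ 0 := pow_ne_zero _ hr
  have h2 : r ^ b ≠ 0 := pow_ne_zero _ hr
  field_simp
  ring

theorem gb_mul_factorial (hr : r ≠ 0) (t s : ℕ) :
    gb r (t + s) s * (qFactorial r s * qFactorial r t) = qFactorial r (t + s) := by
  induction s generalizing t with
  | zero => simp [qFactorial]
  | succ s ihs =>
    induction t with
    | zero =>
      have h := ihs 0
      rw [show 0 + (s + 1) = (0 + s) + 1 by omega, gb_succ, gb_eq_zero (by omega),
        qFactorial_succ (0 + s), ← h, qFactorial_succ]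
      simp
      ring
    | succ t iht =>
      have h := ihs (t + 1)
      have e1 : t + 1 + (s + 1) = (t + 1 + s) + 1 := by omega
      have e2 : t + (s + 1) = t + 1 + s := by omega
      rw [e2] at iht
      rw [e1, gb_succ, qFactorial_succ (t + 1 + s),
        show t + 1 + s + 1 = (t + 1) + (s + 1) by omega, qInt_split hr (t + 1) (s + 1), mul_add]
      nth_rewrite 1 [← iht]
      rw [← h, qFactorial_succ s, qFactorial_succ t]
      push_cast
      rw [show ((t : ℤ) + 1 + s - s) = t + 1 by ring]
      ring

theorem qBinom_eq_gb (hr : r ≠ 0) (h : ∀ n : ℕ, 0 < n → r ^ n ≠ 1) {t s : ℕ} (hs : s ≤ t) :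
    qBinom r t s = gb r t s := by
  rw [qBinom, div_eq_iff (mul_ne_zero (qFactorial_ne_zero hr h _) (qFactorial_ne_zero hr h _))]
  have := gb_mul_factorial hr (t - s) s
  rw [Nat.sub_add_cancel hs] at this
  exact this.symm

theorem qBinom_symm {t s : ℕ} (hs : s ≤ t) : qBinom r t (t - s) = qBinom r t s := by
  rw [qBinom, qBinom, Nat.sub_sub_self hs, mul_comm (qFactorial r (t - s))]

/-- Auxiliary: the iterated `q`-commutator `y_{t+1} = x y_t - p Q^t y_t x`. -/
def adq {B : Type v} [Ring B] [Algebra k B] (p Q : k) (x y : B) : ℕ → B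
  | 0 => y
  | t + 1 => x * adq p Q x y t - (p * Q ^ t) • (adq p Q x y t * x)

variable {B : Type v} [Ring B] [Algebra k B]

theorem adq_expand (hr : r ≠ 0) (N : ℕ) (x y : B) (t : ℕ) :
    adq (r ^ (1 - N : ℤ)) (r ^ 2) x y t =
      ∑ s ∈ Finset.range (t + 1), ((-1) ^ s * (r ^ ((s : ℤ) * (t - N)) * gb r t s)) •
        (x ^ (t - s) * y * x ^ s) := by
  induction t with
  | zero => simp [adq]
  | succ t ih =>
    rw [adq, ih, Finset.sum_range_succ' _ (t + 1)]
    have step : ∀ s, ((-1) ^ (s + 1) * (r ^ (((s + 1 : ℕ) : ℤ) * ((t + 1 : ℕ) - N)) *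
        gb r (t + 1) (s + 1))) • (x ^ (t + 1 - (s + 1)) * y * x ^ (s + 1)) =
      ((-1) ^ (s + 1) * (r ^ (((s + 1 : ℕ) : ℤ) * (t - N)) * gb r t (s + 1))) •
        (x ^ (t + 1 - (s + 1)) * y * x ^ (s + 1))
      - (r ^ (1 - N : ℤ) * (r ^ 2) ^ t) • (((-1) ^ s * (r ^ ((s : ℤ) * (t - N)) * gb r t s)) •
        (x ^ (t - s) * y * x ^ s) * x) := by
      intro s
      rw [smul_mul_assoc, smul_smul, mul_assoc _ (x ^ s) x, ← pow_succ,
        show t + 1 - (s + 1) = t - s by omega, ← sub_smul]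
      congr 1
      rw [gb_succ]
      have e : (r ^ 2) ^ t = r ^ (2 * t : ℤ) := by
        rw [← pow_mul]; norm_cast
      rw [e]
      have e1 : r ^ (((s + 1 : ℕ) : ℤ) * ((t + 1 : ℕ) - N)) * r ^ (-(s + 1 : ℤ)) =
          r ^ (((s + 1 : ℕ) : ℤ) * (t - N)) := by
        rw [← zpow_add₀ hr]; congr 1; push_cast; ring
      have e2 : r ^ (((s + 1 : ℕ) : ℤ) * ((t + 1 : ℕ) - N)) * r ^ ((t : ℤ) - s) =
          r ^ (1 - N : ℤ) * r ^ (2 * t : ℤ) * r ^ ((s : ℤ) * (t - N)) := by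
        rw [← zpow_add₀ hr, ← zpow_add₀ hr, ← zpow_add₀ hr]; congr 1; push_cast; ring
      rw [mul_add, ← mul_assoc, e1, ← mul_assoc _ (r ^ ((t : ℤ) - s)), e2]
      ring
    rw [Finset.sum_congr rfl fun s _ => step s, Finset.sum_sub_distrib, Finset.mul_sum,
      Finset.sum_mul, Finset.smul_sum, sub_add_eq_add_sub]
    congr 1
    refine Eq.trans ?_ ((Finset.sum_range_succ' (fun s => ((-1) ^ s * (r ^ ((s : ℤ) * (t - N)) *
      gb r t s)) • (x ^ (t + 1 - s) * y * x ^ s)) (t + 1)).trans ?_)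
    · rw [Finset.sum_range_succ _ (t + 1), gb_eq_zero (Nat.lt_succ_self t)]
      simp only [mul_zero, zero_smul, add_zero]
      refine Finset.sum_congr rfl fun s hs => ?_
      have : t + 1 - s = (t - s) + 1 := by
        have := Finset.mem_range.mp hs; omega
      rw [this, pow_succ', mul_smul_comm]
      simp only [mul_assoc]
    · simp

theorem serreSum_eq_adq (hr : r ≠ 0) (h : ∀ n : ℕ, 0 < n → r ^ n ≠ 1) (N : ℕ) (x y : B) :
    serreSum r N x y = adq (r ^ (1 - N : ℤ)) (r ^ 2) x y N := by
  rw [adq_expand hr, serreSum]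
  refine Finset.sum_congr rfl fun s hs => ?_
  rw [qBinom_eq_gb hr h (by have := Finset.mem_range.mp hs; omega)]
  simp


/-- Auxiliary: coefficients in the coproduct of an iterated `q`-commutator. -/
def cc (p Q : k) : ℕ → ℕ → k
  | 0, 0 => 1
  | 0, _ + 1 => 0
  | t + 1, 0 => (1 - p ^ 2 * Q ^ t) * cc p Q t 0
  | t + 1, m + 1 => (1 - p ^ 2 * Q ^ (t + (m + 1))) * cc p Q t (m + 1) + Q ^ (t - m) * cc p Q t m

theorem cc_eq_zero {p Q : k} {t m : ℕ} (h : t < m) : cc p Q t m = 0 := by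
  induction t generalizing m with
  | zero => cases m with
    | zero => omega
    | succ m => rfl
  | succ t ih => cases m with
    | zero => omega
    | succ m => rw [cc, ih (by omega), ih (by omega)]; simp

theorem cc_self (p Q : k) (t : ℕ) : cc p Q t t = 1 := by
  induction t with
  | zero => rfl
  | succ t ih => rw [cc, ih, cc_eq_zero (Nat.lt_succ_self t)]; simp

theorem cc_formula (hr : r ≠ 0) (p : k) (m j : ℕ) : cc p (r ^ 2) (m + j) m =
    r ^ (m * j) * gb r (m + j) m * ∏ l ∈ Finset.range j, (1 - p ^ 2 * (r ^ 2) ^ (m + l)) := by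
  induction m generalizing j with
  | zero =>
    induction j with
    | zero => simp [cc]
    | succ j ih =>
      rw [show 0 + (j + 1) = (0 + j) + 1 by omega, cc, ih, Finset.prod_range_succ]
      simp
      ring
  | succ m ihm =>
    induction j with
    | zero => 
      rw [Nat.add_zero, cc_self]
      have h := ihm 0
      rw [Nat.add_zero, cc_self] at h
      rw [gb_succ, gb_eq_zero (Nat.lt_succ_self m)]
      simpa using h
    | succ j ihj =>
      have h := ihm (j + 1)
      have e2 : m + (j + 1) = m + 1 + j := by omega
      rw [e2] at h
      rw [Finset.prod_range_succ' (fun l => 1 - p ^ 2 * (r ^ 2) ^ (m + l)) j] at h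
      rw [show m + 1 + (j + 1) = (m + 1 + j) + 1 by omega, cc, ihj, h]
      have hr' : ∀ n : ℕ, r ^ n ≠ 0 := fun n => pow_ne_zero _ hr
      have g1 : r ^ (m + 1) * gb r (m + 1 + j + 1) (m + 1) =
          gb r (m + 1 + j) (m + 1) + r ^ (m + j + 2) * gb r (m + 1 + j) m := by
        rw [gb_succ, mul_add, ← mul_assoc, ← mul_assoc, ← zpow_natCast, ← zpow_add₀ hr,
          ← zpow_add₀ hr, ← zpow_natCast r (m + j + 2)]
        push_cast
        congr 1
        · simp
        · congr 2; ring
      have g2 : r ^ (j + 1) * gb r (m + 1 + j + 1) (m + 1) =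
          r ^ (m + j + 2) * gb r (m + 1 + j) (m + 1) + gb r (m + 1 + j) m := by
        rw [gb_succ' hr, mul_add, ← mul_assoc, ← mul_assoc, ← zpow_natCast, ← zpow_add₀ hr,
          ← zpow_add₀ hr, ← zpow_natCast r (m + j + 2)]
        push_cast
        congr 1
        · congr 2; ring
        · rw [show ((j : ℤ) + 1 + (m - (m + 1 + j))) = 0 by ring]; simp
      rw [Finset.prod_range_succ (fun l => 1 - p ^ 2 * (r ^ 2) ^ (m + 1 + l)) j]
      simp only [show ∀ l, m + 1 + l = m + (l + 1) by intro l; omega] at *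
      set P := ∏ l ∈ Finset.range j, (1 - p ^ 2 * (r ^ 2) ^ (m + (l + 1)))
      rw [show m + (j + 1) - m = j + 1 by omega]
      set X := gb r (m + (j + 1) + 1) (m + 1)
      set Y := gb r (m + (j + 1)) (m + 1)
      set Z := gb r (m + (j + 1)) m
      have : r ^ ((m + 1) * (j + 1)) * X * (P * (1 - p ^ 2 * (r ^ 2) ^ (m + (j + 1)))) =
          r ^ ((m + 1) * j) * P * (r ^ (m + 1) * X) - p ^ 2 * r ^ (m * j + 3 * m + 2 * j + 2) * P *
            (r ^ (j + 1) * X) := by ring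
      rw [this, g1, g2]
      ring

theorem cc_vanish (hr : r ≠ 0) {N m : ℕ} (h : m < N) :
    cc (r ^ (1 - N : ℤ)) (r ^ 2) N m = 0 := by
  obtain ⟨j, rfl⟩ := Nat.exists_eq_add_of_lt h
  rw [add_assoc, cc_formula hr, Finset.prod_eq_zero (i := j) (by simp), mul_zero]
  rw [sub_eq_zero, ← pow_mul, ← zpow_natCast, ← zpow_natCast, ← zpow_mul, ← zpow_add₀ hr]
  symm
  convert zpow_zero r
  push_cast
  ring

/-- The commutation rules of `x = E_i`, `y = E_j`, `K = K_i`, `L = K_j`. -/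
structure SkewRel (p Q : k) (x y K L : B) : Prop where
  KL : K * L = L * K
  Kx : K * x = Q • (x * K)
  Lx : L * x = p • (x * L)
  Ky : K * y = p • (y * K)

namespace SkewRel

variable {p Q : k} {x y K L : B}

theorem K_adq (h : SkewRel p Q x y K L) (t : ℕ) : K * adq p Q x y t = (p * Q ^ t) • (adq p Q x y t * K) := by
  induction t with
  | zero => simpa [adq] using h.Ky
  | succ t ih =>
    have a1 : K * (x * adq p Q x y t) = (p * Q ^ (t + 1)) • (x * adq p Q x y t * K) := by
      rw [← mul_assoc, h.Kx, smul_mul_assoc, mul_assoc, ih, mul_smul_comm, smul_smul, mul_assoc]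
      congr 1; ring
    have a2 : K * (adq p Q x y t * x) = (p * Q ^ (t + 1)) • (adq p Q x y t * x * K) := by
      rw [← mul_assoc, ih, smul_mul_assoc, mul_assoc, h.Kx, mul_smul_comm, smul_smul, ← mul_assoc]
      congr 1; ring
    rw [adq, mul_sub, mul_smul_comm, a1, a2, sub_mul, smul_sub, smul_mul_assoc, smul_comm]

theorem Kpow_x (h : SkewRel p Q x y K L) (m : ℕ) : K ^ m * x = Q ^ m • (x * K ^ m) := by
  induction m with
  | zero => simp
  | succ m ih =>
    rw [pow_succ, mul_assoc, h.Kx, mul_smul_comm, ← mul_assoc, ih, smul_mul_assoc, smul_smul,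
      mul_assoc, pow_succ Q, mul_comm Q]

theorem K_xpow (h : SkewRel p Q x y K L) (m : ℕ) : K * x ^ m = Q ^ m • (x ^ m * K) := by
  induction m with
  | zero => simp
  | succ m ih =>
    rw [pow_succ, ← mul_assoc, ih, smul_mul_assoc, mul_assoc, h.Kx, mul_smul_comm, smul_smul,
      ← mul_assoc, pow_succ Q]

theorem KpowL_x (h : SkewRel p Q x y K L) (m : ℕ) : K ^ m * L * x = (p * Q ^ m) • (x * (K ^ m * L)) := by
  rw [mul_assoc, h.Lx, mul_smul_comm, ← mul_assoc, h.Kpow_x, smul_mul_assoc, smul_smul, mul_assoc]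

theorem KpowL_K (h : SkewRel p Q x y K L) (m : ℕ) : K ^ m * L * K = K ^ (m + 1) * L := by
  rw [mul_assoc, ← h.KL, ← mul_assoc, ← pow_succ]

theorem adq_comul (h : SkewRel p Q x y K L) (t : ℕ) :
    adq p Q (x ⊗ₜ[k] (1 : B) + K ⊗ₜ x) (y ⊗ₜ (1 : B) + L ⊗ₜ y) t =
      adq p Q x y t ⊗ₜ 1 + ∑ m ∈ Finset.range (t + 1),
        cc p Q t m • ((x ^ (t - m) * (K ^ m * L)) ⊗ₜ adq p Q x y m) := by
  induction t with
  | zero => simp [adq, cc]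
  | succ t ih =>
    rw [adq, ih]
    set X := x ⊗ₜ[k] (1 : B) + K ⊗ₜ x with hX
    have s1 : X * (adq p Q x y t ⊗ₜ 1) - (p * Q ^ t) • ((adq p Q x y t ⊗ₜ 1) * X) =
        adq p Q x y (t + 1) ⊗ₜ[k] (1 : B) := by
      simp only [hX, add_mul, mul_add, Algebra.TensorProduct.tmul_mul_tmul, mul_one, one_mul,
        h.K_adq, adq, TensorProduct.sub_tmul, TensorProduct.smul_tmul', smul_add]
      abel
    have s2 : ∀ m ∈ Finset.range (t + 1),
        X * (cc p Q t m • ((x ^ (t - m) * (K ^ m * L)) ⊗ₜ adq p Q x y m)) -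
          (p * Q ^ t) • ((cc p Q t m • ((x ^ (t - m) * (K ^ m * L)) ⊗ₜ adq p Q x y m)) * X) =
        ((1 - p ^ 2 * Q ^ (t + m)) * cc p Q t m) •
          ((x ^ (t + 1 - m) * (K ^ m * L)) ⊗ₜ[k] adq p Q x y m) +
        (Q ^ (t - m) * cc p Q t m) •
          ((x ^ (t + 1 - (m + 1)) * (K ^ (m + 1) * L)) ⊗ₜ[k] adq p Q x y (m + 1)) := by
      intro m hm
      have hm' : m ≤ t := by have := Finset.mem_range.mp hm; omega
      have b1 : x * (x ^ (t - m) * (K ^ m * L)) = x ^ (t + 1 - m) * (K ^ m * L) := by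
        rw [← mul_assoc, ← pow_succ', show t - m + 1 = t + 1 - m by omega]
      have b2 : x ^ (t - m) * (K ^ m * L) * x =
          (p * Q ^ m) • (x ^ (t + 1 - m) * (K ^ m * L)) := by
        rw [mul_assoc, h.KpowL_x, mul_smul_comm, ← mul_assoc, ← pow_succ,
          show t - m + 1 = t + 1 - m by omega]
      have b3 : K * (x ^ (t - m) * (K ^ m * L)) =
          Q ^ (t - m) • (x ^ (t - m) * (K ^ (m + 1) * L)) := by
        rw [← mul_assoc, h.K_xpow, smul_mul_assoc, pow_succ', mul_assoc, mul_assoc]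
      have b4 : x ^ (t - m) * (K ^ m * L) * K = x ^ (t - m) * (K ^ (m + 1) * L) := by
        rw [mul_assoc, h.KpowL_K]
      rw [show t + 1 - (m + 1) = t - m by omega]
      rw [mul_smul_comm, smul_mul_assoc, hX, add_mul, mul_add]
      simp only [Algebra.TensorProduct.tmul_mul_tmul, mul_one, one_mul, b1, b2, b3, b4, adq,
        TensorProduct.tmul_sub, TensorProduct.tmul_smul, ← TensorProduct.smul_tmul', smul_add,
        smul_sub, smul_smul]
      have e : Q ^ t = Q ^ (t - m) * Q ^ m := by rw [← pow_add]; congr 1; omega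
      generalize (x ^ (t + 1 - m) * (K ^ m * L)) ⊗ₜ[k] adq p Q x y m = T1
      generalize (x ^ (t - m) * (K ^ (m + 1) * L)) ⊗ₜ[k] (x * adq p Q x y m) = T2
      generalize (x ^ (t - m) * (K ^ (m + 1) * L)) ⊗ₜ[k] (adq p Q x y m * x) = T3
      rw [pow_add, e]
      module
    clear_value X
    rw [mul_add, add_mul, smul_add, add_sub_add_comm, s1, Finset.mul_sum, Finset.sum_mul,
      Finset.smul_sum, ← Finset.sum_sub_distrib, Finset.sum_congr rfl s2, Finset.sum_add_distrib,
      Finset.sum_range_succ' _ (t + 1)]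
    congr 1
    simp only [cc, add_smul, Finset.sum_add_distrib]
    have z : ∑ m ∈ Finset.range (t + 1), ((1 - p ^ 2 * Q ^ (t + m)) * cc p Q t m) •
          ((x ^ (t + 1 - m) * (K ^ m * L)) ⊗ₜ[k] adq p Q x y m) =
        ∑ m ∈ Finset.range (t + 1 + 1), ((1 - p ^ 2 * Q ^ (t + m)) * cc p Q t m) •
          ((x ^ (t + 1 - m) * (K ^ m * L)) ⊗ₜ[k] adq p Q x y m) := by
      rw [Finset.sum_range_succ _ (t + 1), cc_eq_zero (Nat.lt_succ_self t)]
      simp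
    rw [z, Finset.sum_range_succ' _ (t + 1)]
    simp only [add_zero]
    abel

/-- Twisting `x`, `y` by inverse Cartan elements only rescales the iterated `q`-commutators. -/
theorem adq_twist (h : SkewRel p Q x y K L)
    {Ki Li : B} (hK : Ki * K = 1) (hK' : K * Ki = 1) (hL : Li * L = 1)
    (hL' : L * Li = 1) (μ ν : k) (t : ℕ) :
    ∃ c : k, adq p Q (μ • (Ki * x)) (ν • (Li * y)) t = c • (Ki ^ t * Li * adq p Q x y t) := by
  have c1 : Ki * Li = Li * Ki := by
    let uK : Bˣ := ⟨K, Ki, hK', hK⟩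
    let uL : Bˣ := ⟨L, Li, hL', hL⟩
    have c : Commute (uK : B) (uL : B) := h.KL
    exact (c.units_inv_left.units_inv_right : Commute ((uK⁻¹ : Bˣ) : B) ((uL⁻¹ : Bˣ) : B))
  have xK : x * Ki = Q • (Ki * x) := by
    calc x * Ki = Ki * (K * x) * Ki := by rw [← mul_assoc, hK, one_mul]
      _ = _ := by rw [h.Kx, mul_smul_comm, smul_mul_assoc, mul_assoc, mul_assoc, hK', mul_one]
  have xL : x * Li = p • (Li * x) := by
    calc x * Li = Li * (L * x) * Li := by rw [← mul_assoc, hL, one_mul]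
      _ = _ := by rw [h.Lx, mul_smul_comm, smul_mul_assoc, mul_assoc, mul_assoc, hL', mul_one]
  have xKt : ∀ t, x * Ki ^ t = Q ^ t • (Ki ^ t * x) := by
    intro t
    induction t with
    | zero => simp
    | succ t ih =>
      rw [pow_succ, ← mul_assoc, ih, smul_mul_assoc, mul_assoc, xK, mul_smul_comm, smul_smul,
        ← mul_assoc, pow_succ Q]
  have c2 : ∀ t, x * (Ki ^ t * Li) = (p * Q ^ t) • (Ki ^ t * Li * x) := by
    intro t
    rw [← mul_assoc, xKt, smul_mul_assoc, mul_assoc, xL, mul_smul_comm, smul_smul, ← mul_assoc,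
      mul_comm p]
  have c3 : ∀ t, adq p Q x y t * Ki = (p * Q ^ t) • (Ki * adq p Q x y t) := by
    intro t
    have := h.K_adq t
    calc adq p Q x y t * Ki = Ki * (K * adq p Q x y t) * Ki := by rw [← mul_assoc, hK, one_mul]
      _ = _ := by rw [this, mul_smul_comm, smul_mul_assoc, mul_assoc, mul_assoc, hK', mul_one]
  induction t with
  | zero => exact ⟨ν, by simp [adq]⟩
  | succ t ih =>
    obtain ⟨c, hc⟩ := ih
    refine ⟨μ * c * (p * Q ^ t), ?_⟩
    have d1 : Ki * x * (Ki ^ t * Li * adq p Q x y t) =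
        (p * Q ^ t) • (Ki ^ (t + 1) * Li * (x * adq p Q x y t)) := by
      rw [mul_assoc Ki, ← mul_assoc x, c2, smul_mul_assoc, mul_smul_comm, pow_succ']
      simp only [mul_assoc]
    have d2 : Ki ^ t * Li * adq p Q x y t * (Ki * x) =
        (p * Q ^ t) • (Ki ^ (t + 1) * Li * (adq p Q x y t * x)) := by
      rw [mul_assoc, ← mul_assoc (adq p Q x y t), c3, smul_mul_assoc, mul_smul_comm, pow_succ]
      simp only [← mul_assoc]
      rw [mul_assoc _ Li, ← c1, ← mul_assoc]
    rw [adq, hc, adq, mul_sub, mul_smul_comm, smul_sub]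
    simp only [smul_mul_assoc, mul_smul_comm, d1, d2, smul_smul]
    congr 2
    · ring
    · ring

end SkewRel

end QuantumIntegers

theorem serreSum_op {k : Type u} [Field k] {B : Type v} [Ring B] [Algebra k B] (r : k) (N : ℕ)
    (x y : B) : serreSum r N (MulOpposite.op x) (MulOpposite.op y) =
      MulOpposite.op ((-1 : k) ^ N • serreSum r N x y) := by
  rw [serreSum, serreSum, ← Finset.sum_range_reflect, Finset.smul_sum, ← MulOpposite.coe_opLinearEquiv (R := k), map_sum]
  simp only [MulOpposite.coe_opLinearEquiv]
  refine Finset.sum_congr rfl fun s hs => ?_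
  have hs' : s ≤ N := by have := Finset.mem_range.mp hs; omega
  rw [show N + 1 - 1 - s = N - s by omega, Nat.sub_sub_self hs', qBinom_symm hs', smul_smul,
    MulOpposite.op_smul]
  congr 1
  · rw [← mul_assoc]
    congr 1
    obtain ⟨j, rfl⟩ := Nat.exists_eq_add_of_le hs'
    rw [Nat.add_sub_cancel_left, pow_add, mul_comm ((-1 : k) ^ s), mul_assoc, ← pow_add,
      Even.neg_one_pow (Even.add_self s), mul_one]
  · simp [mul_assoc]

theorem map_serreSum {k : Type u} [Field k] {B : Type v} [Ring B] [Algebra k B] {C : Type w}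
    [Ring C] [Algebra k C] (f : B →ₐ[k] C) (r : k) (N : ℕ) (x y : B) :
    f (serreSum r N x y) = serreSum r N (f x) (f y) := by
  simp [serreSum]

/-! ### The half quantum group -/

/-- A symmetrizable generalized Cartan matrix `A = (a_{ij})` with a symmetrizer
`D = diag(d_i)`, `d_i a_{ij} = d_j a_{ji}`, and a parameter `q` that is not a root of unity. -/
structure QuantumDatum (k : Type u) [Field k] (ι : Type v) where
  A : Matrix ι ι ℤ
  d : ι → ℕ
  q : k
  diag : ∀ i, A i i = 2
  off_diag : ∀ i j, i ≠ j → A i j ≤ 0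
  d_pos : ∀ i, 0 < d i
  symm : ∀ i j, (d i : ℤ) * A i j = d j * A j i
  q_ne_zero : q ≠ 0
  q_generic : ∀ n : ℕ, 0 < n → q ^ n ≠ 1

variable {k : Type u} [Field k] {ι : Type v}

/-- `q_i = q ^ (d_i)`. -/
def QuantumDatum.qi (P : QuantumDatum k ι) (i : ι) : k := P.q ^ P.d i

/-- The generators `E_i`, `K_i`, `K_i⁻¹`. -/
inductive Gen (ι : Type v) : Type v
  | E : ι → Gen ι
  | K : ι → Gen ι
  | Kinv : ι → Gen ι

/-- The defining relations. -/
inductive Rel (P : QuantumDatum k ι) : FreeAlgebra k (Gen ι) → FreeAlgebra k (Gen ι) → Prop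
  | K_comm (i j : ι) : Rel P
      (FreeAlgebra.ι k (.K i) * FreeAlgebra.ι k (.K j))
      (FreeAlgebra.ι k (.K j) * FreeAlgebra.ι k (.K i))
  | K_mul_Kinv (i : ι) : Rel P (FreeAlgebra.ι k (.K i) * FreeAlgebra.ι k (.Kinv i)) 1
  | Kinv_mul_K (i : ι) : Rel P (FreeAlgebra.ι k (.Kinv i) * FreeAlgebra.ι k (.K i)) 1
  | K_conj_E (i j : ι) : Rel P
      (FreeAlgebra.ι k (.K i) * FreeAlgebra.ι k (.E j) * FreeAlgebra.ι k (.Kinv i))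
      (P.qi j ^ P.A j i • FreeAlgebra.ι k (.E j))
  | serre (i j : ι) (hij : i ≠ j) : Rel P
      (serreSum (P.qi i) (1 - P.A i j).toNat (FreeAlgebra.ι k (.E i)) (FreeAlgebra.ι k (.E j))) 0

/-- The half quantum group `U^{≥0}`. -/
def U (P : QuantumDatum k ι) : Type (max u v) := RingQuot (Rel P)

namespace U

variable (P : QuantumDatum k ι)

instance : Ring (U P) := inferInstanceAs (Ring (RingQuot (Rel P)))

instance : Algebra k (U P) := inferInstanceAs (Algebra k (RingQuot (Rel P)))

/-- The quotient map from the free algebra. -/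
def mk : FreeAlgebra k (Gen ι) →ₐ[k] U P := RingQuot.mkAlgHom k (Rel P)

theorem mk_rel {a b : FreeAlgebra k (Gen ι)} (h : Rel P a b) : mk P a = mk P b :=
  RingQuot.mkAlgHom_rel k h

/-- The generator `E_i`. -/
def E (i : ι) : U P := mk P (FreeAlgebra.ι k (.E i))

/-- The generator `K_i`. -/
def K (i : ι) : U P := mk P (FreeAlgebra.ι k (.K i))

/-- The generator `K_i⁻¹`. -/
def Kinv (i : ι) : U P := mk P (FreeAlgebra.ι k (.Kinv i))

variable {P}

theorem K_comm (i j : ι) : K P i * K P j = K P j * K P i := by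
  simpa [E, K, Kinv] using mk_rel P (Rel.K_comm i j)

theorem K_mul_Kinv (i : ι) : K P i * Kinv P i = 1 := by
  simpa [E, K, Kinv] using mk_rel P (Rel.K_mul_Kinv i)

theorem Kinv_mul_K (i : ι) : Kinv P i * K P i = 1 := by
  simpa [E, K, Kinv] using mk_rel P (Rel.Kinv_mul_K i)

theorem K_conj_E (i j : ι) : K P i * E P j * Kinv P i = P.qi j ^ P.A j i • E P j := by
  simpa [E, K, Kinv] using mk_rel P (Rel.K_conj_E i j)

theorem serre {i j : ι} (hij : i ≠ j) :
    serreSum (P.qi i) (1 - P.A i j).toNat (E P i) (E P j) = 0 := by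
  have := mk_rel P (Rel.serre i j hij)
  rw [map_serreSum, map_zero] at this
  exact this

theorem K_mul_E (i j : ι) : K P i * E P j = P.qi j ^ P.A j i • (E P j * K P i) := by
  rw [← smul_mul_assoc, ← K_conj_E, mul_assoc _ (Kinv P i), Kinv_mul_K, mul_one]

/-- The relations that images of the generators in an algebra have to satisfy. -/
structure Sat (P : QuantumDatum k ι) {B : Type w} [Ring B] [Algebra k B]
    (e κ κ' : ι → B) : Prop where
  K_comm : ∀ i j, κ i * κ j = κ j * κ i
  K_mul_Kinv : ∀ i, κ i * κ' i = 1
  Kinv_mul_K : ∀ i, κ' i * κ i = 1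
  K_mul_E : ∀ i j, κ i * e j = P.qi j ^ P.A j i • (e j * κ i)
  serre : ∀ i j, i ≠ j → serreSum (P.qi i) (1 - P.A i j).toNat (e i) (e j) = 0

/-- The map on generators. -/
def genMap {B : Type w} (e κ κ' : ι → B) : Gen ι → B
  | .E i => e i
  | .K i => κ i
  | .Kinv i => κ' i

/-- The universal property of `U^{≥0}`. -/
def lift {B : Type w} [Ring B] [Algebra k B] {e κ κ' : ι → B} (h : Sat P e κ κ') : U P →ₐ[k] B :=
  RingQuot.liftAlgHom k ⟨FreeAlgebra.lift k (genMap e κ κ'), by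
    intro a b hab
    induction hab with
    | K_comm i j => simpa [genMap] using h.K_comm i j
    | K_mul_Kinv i => simpa [genMap] using h.K_mul_Kinv i
    | Kinv_mul_K i => simpa [genMap] using h.Kinv_mul_K i
    | K_conj_E i j =>
      simp only [map_mul, map_smul, FreeAlgebra.lift_ι_apply, genMap, h.K_mul_E, smul_mul_assoc]
      rw [mul_assoc, h.K_mul_Kinv, mul_one]
    | serre i j hij => simpa [map_serreSum, genMap] using h.serre i j hij⟩

section lift

variable {B : Type w} [Ring B] [Algebra k B] {e κ κ' : ι → B} (h : Sat P e κ κ')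

theorem lift_mk (a : FreeAlgebra k (Gen ι)) :
    lift h (mk P a) = FreeAlgebra.lift k (genMap e κ κ') a :=
  RingQuot.liftAlgHom_mkAlgHom_apply _ _ _ _

@[simp] theorem lift_E (i : ι) : lift h (E P i) = e i := by
  simp [E, lift_mk, genMap]

@[simp] theorem lift_K (i : ι) : lift h (K P i) = κ i := by
  simp [K, lift_mk, genMap]

@[simp] theorem lift_Kinv (i : ι) : lift h (Kinv P i) = κ' i := by
  simp [Kinv, lift_mk, genMap]

theorem hom_ext {f g : U P →ₐ[k] B} (hE : ∀ i, f (E P i) = g (E P i))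
    (hK : ∀ i, f (K P i) = g (K P i)) : f = g := by
  have hKi : ∀ i, f (Kinv P i) = g (Kinv P i) := by
    intro i
    calc f (Kinv P i) = f (Kinv P i) * g (K P i * Kinv P i) := by simp [K_mul_Kinv]
      _ = f (Kinv P i * K P i) * g (Kinv P i) := by rw [map_mul, map_mul, hK, mul_assoc]
      _ = g (Kinv P i) := by simp [Kinv_mul_K]
  apply RingQuot.ringQuot_ext' k
  apply FreeAlgebra.hom_ext
  funext x
  cases x with
  | E i => exact hE i
  | K i => exact hK i
  | Kinv i => exact hKi i

/-- Induction on the generators. -/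
theorem induction {C : U P → Prop} (hs : ∀ c : k, C (algebraMap k _ c))
    (hE : ∀ i, C (E P i)) (hK : ∀ i, C (K P i)) (hKinv : ∀ i, C (Kinv P i))
    (hadd : ∀ a b, C a → C b → C (a + b)) (hmul : ∀ a b, C a → C b → C (a * b)) (a : U P) :
    C a := by
  obtain ⟨a, rfl⟩ := RingQuot.mkAlgHom_surjective k (Rel P) a
  change C (mk P a)
  induction a using FreeAlgebra.induction with
  | grade0 c => simpa using hs c
  | grade1 x => cases x with
    | E i => exact hE i
    | K i => exact hK i
    | Kinv i => exact hKinv i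
  | mul a b ha hb => simpa using hmul _ _ ha hb
  | add a b ha hb => simpa using hadd _ _ ha hb

end lift

theorem qi_ne_zero (i : ι) : P.qi i ≠ 0 := pow_ne_zero _ P.q_ne_zero

theorem qi_generic (i : ι) (n : ℕ) (hn : 0 < n) : P.qi i ^ n ≠ 1 := by
  rw [QuantumDatum.qi, ← pow_mul]
  exact P.q_generic _ (Nat.mul_pos (P.d_pos i) hn)

theorem qi_symm (i j : ι) : P.qi i ^ P.A i j = P.qi j ^ P.A j i := by
  rw [QuantumDatum.qi, QuantumDatum.qi, ← zpow_natCast, ← zpow_natCast, ← zpow_mul, ← zpow_mul,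
    P.symm]

theorem qi_diag (i : ι) : P.qi i ^ P.A i i = P.qi i ^ 2 := by
  rw [P.diag]; norm_cast

theorem pow_eq {i j : ι} (hij : i ≠ j) :
    P.qi i ^ (1 - ((1 - P.A i j).toNat : ℤ)) = P.qi i ^ P.A i j := by
  congr 1
  have := P.off_diag i j hij
  omega

theorem serre_iff {B : Type w} [Ring B] [Algebra k B] {i j : ι} (hij : i ≠ j) (x y : B) :
    serreSum (P.qi i) (1 - P.A i j).toNat x y =
      adq (P.qi i ^ P.A i j) (P.qi i ^ 2) x y (1 - P.A i j).toNat := by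
  rw [serreSum_eq_adq (qi_ne_zero i) (qi_generic i), pow_eq hij]

theorem skewRel (i j : ι) : SkewRel (P.qi i ^ P.A i j) (P.qi i ^ 2) (E P i) (E P j)
    (K P i) (K P j) where
  KL := K_comm i j
  Kx := by rw [K_mul_E, qi_diag]
  Lx := K_mul_E j i
  Ky := by rw [K_mul_E, qi_symm]

open TensorProduct in
theorem comul_sat : Sat P (B := U P ⊗[k] U P) (fun i => E P i ⊗ₜ 1 + K P i ⊗ₜ E P i)
    (fun i => K P i ⊗ₜ K P i) (fun i => Kinv P i ⊗ₜ Kinv P i) where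
  K_comm i j := by simp [K_comm i j]
  K_mul_Kinv i := by simp [K_mul_Kinv, Algebra.TensorProduct.one_def]
  Kinv_mul_K i := by simp [Kinv_mul_K, Algebra.TensorProduct.one_def]
  K_mul_E i j := by
    simp only [mul_add, add_mul, Algebra.TensorProduct.tmul_mul_tmul, mul_one, one_mul, K_mul_E,
      smul_add, smul_tmul', tmul_smul, K_comm i j]
  serre i j hij := by
    rw [serre_iff hij, (skewRel i j).adq_comul]
    have h0 := serre (P := P) hij
    rw [serre_iff hij] at h0
    rw [Finset.sum_range_succ, h0, zero_tmul, tmul_zero, smul_zero, add_zero, zero_add]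
    refine Finset.sum_eq_zero fun m hm => ?_
    rw [← pow_eq hij, cc_vanish (qi_ne_zero i) (Finset.mem_range.mp hm), zero_smul]

/-- The comultiplication: `E_i ↦ E_i ⊗ 1 + K_i ⊗ E_i`, `K_i ↦ K_i ⊗ K_i`. -/
def comulHom : U P →ₐ[k] U P ⊗[k] U P := lift comul_sat

theorem counit_sat : Sat P (B := k) (fun _ => 0) (fun _ => 1) (fun _ => 1) where
  K_comm i j := by simp
  K_mul_Kinv i := by simp
  Kinv_mul_K i := by simp
  K_mul_E i j := by simp
  serre i j hij := by simp [serreSum]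

/-- The counit: `E_i ↦ 0`, `K_i ↦ 1`. -/
def counitHom : U P →ₐ[k] k := lift counit_sat

variable (P) in
instance : Bialgebra k (U P) := Bialgebra.ofAlgHom comulHom counitHom
  (by
    apply hom_ext
    · intro i
      simp [comulHom, TensorProduct.add_tmul, TensorProduct.tmul_add,
        Algebra.TensorProduct.one_def, add_assoc]
    · intro i; simp [comulHom])
  (by apply hom_ext <;> intro i <;> simp [comulHom, counitHom])
  (by apply hom_ext <;> intro i <;> simp [comulHom, counitHom])

@[simp] theorem comul_E (i : ι) : Coalgebra.comul (R := k) (E P i) =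
    E P i ⊗ₜ 1 + K P i ⊗ₜ E P i := lift_E comul_sat i

@[simp] theorem comul_K (i : ι) : Coalgebra.comul (R := k) (K P i) = K P i ⊗ₜ K P i :=
  lift_K comul_sat i

@[simp] theorem comul_Kinv (i : ι) :
    Coalgebra.comul (R := k) (Kinv P i) = Kinv P i ⊗ₜ Kinv P i := lift_Kinv comul_sat i

@[simp] theorem counit_E (i : ι) : Coalgebra.counit (R := k) (E P i) = 0 := lift_E counit_sat i

@[simp] theorem counit_K (i : ι) : Coalgebra.counit (R := k) (K P i) = 1 := lift_K counit_sat i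

@[simp] theorem counit_Kinv (i : ι) : Coalgebra.counit (R := k) (Kinv P i) = 1 :=
  lift_Kinv counit_sat i

theorem anti_sat (μ : ι → k) : Sat P (B := (U P)ᵐᵒᵖ)
    (fun i => MulOpposite.op (μ i • (Kinv P i * E P i))) (fun i => MulOpposite.op (Kinv P i))
    (fun i => MulOpposite.op (K P i)) where
  K_comm i j := by
    rw [← MulOpposite.op_mul, ← MulOpposite.op_mul]
    congr 1
    let u : ι → (U P)ˣ := fun i => ⟨K P i, Kinv P i, K_mul_Kinv i, Kinv_mul_K i⟩
    have c : Commute (u j : U P) (u i : U P) := K_comm j i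
    exact (c.units_inv_left.units_inv_right :
      Commute (((u j)⁻¹ : (U P)ˣ) : U P) (((u i)⁻¹ : (U P)ˣ) : U P))
  K_mul_Kinv i := by rw [← MulOpposite.op_mul, K_mul_Kinv, MulOpposite.op_one]
  Kinv_mul_K i := by rw [← MulOpposite.op_mul, Kinv_mul_K, MulOpposite.op_one]
  K_mul_E i j := by
    rw [← MulOpposite.op_mul, ← MulOpposite.op_mul, ← MulOpposite.op_smul]
    congr 1
    let u : ι → (U P)ˣ := fun i => ⟨K P i, Kinv P i, K_mul_Kinv i, Kinv_mul_K i⟩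
    have c : Commute (u i : U P) (u j : U P) := K_comm i j
    have c' : Kinv P i * Kinv P j = Kinv P j * Kinv P i := (c.units_inv_left.units_inv_right :
      Commute (((u i)⁻¹ : (U P)ˣ) : U P) (((u j)⁻¹ : (U P)ˣ) : U P))
    have e : E P j * Kinv P i = P.qi j ^ P.A j i • (Kinv P i * E P j) := by
      rw [← mul_smul_comm, ← K_conj_E, ← mul_assoc, ← mul_assoc, Kinv_mul_K, one_mul]
    rw [smul_mul_assoc, mul_assoc, e, mul_smul_comm, mul_smul_comm, smul_comm, ← mul_assoc,
      ← mul_assoc, c']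
  serre i j hij := by
    obtain ⟨c, hc⟩ := (skewRel (P := P) i j).adq_twist (Kinv_mul_K i) (K_mul_Kinv i)
      (Kinv_mul_K j) (K_mul_Kinv j) (μ i) (μ j) (1 - P.A i j).toNat
    have h0 := serre (P := P) hij
    rw [serre_iff hij] at h0
    rw [serreSum_op, serre_iff hij, hc, h0, mul_zero, smul_zero, smul_zero, MulOpposite.op_zero]

/-- The antipode as an algebra map to the opposite algebra: `E_i ↦ -K_i⁻¹ E_i`, `K_i ↦ K_i⁻¹`. -/
def antipodeHom : U P →ₐ[k] (U P)ᵐᵒᵖ := lift (anti_sat fun _ => -1)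

/-- The inverse of the antipode as an algebra map to the opposite algebra:
`E_i ↦ -q_i² K_i⁻¹ E_i = -E_i K_i⁻¹`, `K_i ↦ K_i⁻¹`. -/
def antipodeInvHom : U P →ₐ[k] (U P)ᵐᵒᵖ := lift (anti_sat fun i => -P.qi i ^ 2)

/-- The antipode as a linear map. -/
def S : U P →ₗ[k] U P := (MulOpposite.opLinearEquiv k).symm.toLinearMap ∘ₗ antipodeHom.toLinearMap

/-- The inverse of the antipode as a linear map. -/
def Sinv : U P →ₗ[k] U P :=
  (MulOpposite.opLinearEquiv k).symm.toLinearMap ∘ₗ antipodeInvHom.toLinearMap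

theorem S_apply (a : U P) : S a = (antipodeHom a).unop := rfl

theorem Sinv_apply (a : U P) : Sinv a = (antipodeInvHom a).unop := rfl

@[simp] theorem S_one : S (1 : U P) = 1 := by simp [S_apply]
@[simp] theorem S_mul (a b : U P) : S (a * b) = S b * S a := by simp [S_apply]
@[simp] theorem S_E (i : ι) : S (E P i) = -(Kinv P i * E P i) := by
  simp [S_apply, antipodeHom]
@[simp] theorem S_K (i : ι) : S (K P i) = Kinv P i := by simp [S_apply, antipodeHom]
@[simp] theorem S_Kinv (i : ι) : S (Kinv P i) = K P i := by simp [S_apply, antipodeHom]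
@[simp] theorem Sinv_one : Sinv (1 : U P) = 1 := by simp [Sinv_apply]
@[simp] theorem Sinv_mul (a b : U P) : Sinv (a * b) = Sinv b * Sinv a := by simp [Sinv_apply]
theorem E_mul_Kinv (i : ι) : E P i * Kinv P i = P.qi i ^ 2 • (Kinv P i * E P i) := by
  rw [← qi_diag, ← mul_smul_comm, ← K_conj_E, ← mul_assoc, ← mul_assoc, Kinv_mul_K, one_mul]
@[simp] theorem Sinv_E (i : ι) : Sinv (E P i) = -(E P i * Kinv P i) := by
  simp [Sinv_apply, antipodeInvHom, E_mul_Kinv]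
@[simp] theorem Sinv_K (i : ι) : Sinv (K P i) = Kinv P i := by simp [Sinv_apply, antipodeInvHom]
@[simp] theorem Sinv_Kinv (i : ι) : Sinv (Kinv P i) = K P i := by
  simp [Sinv_apply, antipodeInvHom]

theorem S_algebraMap (c : k) : S (algebraMap k (U P) c) = algebraMap k (U P) c := by
  simp [S_apply]

theorem Sinv_algebraMap (c : k) : Sinv (algebraMap k (U P) c) = algebraMap k (U P) c := by
  simp [Sinv_apply]

theorem S_Sinv (a : U P) : S (Sinv a) = a := by
  induction a using induction with
  | hs c => rw [Sinv_algebraMap, S_algebraMap]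
  | hE i => simp [← mul_assoc, K_mul_Kinv]
  | hK i => simp
  | hKinv i => simp
  | hadd a b ha hb => simp [ha, hb]
  | hmul a b ha hb => simp [ha, hb]

theorem Sinv_S (a : U P) : Sinv (S a) = a := by
  induction a using induction with
  | hs c => rw [S_algebraMap, Sinv_algebraMap]
  | hE i => simp [mul_assoc, Kinv_mul_K]
  | hK i => simp
  | hKinv i => simp
  | hadd a b ha hb => simp [ha, hb]
  | hmul a b ha hb => simp [ha, hb]


theorem S_left_mul (t : U P ⊗[k] U P) (b c : U P) :
    LinearMap.mul' k (U P) ((S.rTensor (U P)) (t * (b ⊗ₜ c))) =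
      S b * LinearMap.mul' k (U P) ((S.rTensor (U P)) t) * c := by
  induction t with
  | zero => simp
  | tmul x y => simp [mul_assoc]
  | add x y hx hy => simp only [add_mul, map_add, hx, hy, mul_add]

theorem S_right_mul (t : U P ⊗[k] U P) (b c : U P) :
    LinearMap.mul' k (U P) ((S.lTensor (U P)) ((b ⊗ₜ c) * t)) =
      b * LinearMap.mul' k (U P) ((S.lTensor (U P)) t) * S c := by
  induction t with
  | zero => simp
  | tmul x y => simp [mul_assoc]
  | add x y hx hy => simp only [add_mul, map_add, hx, hy, mul_add]

theorem S_left (a : U P) : LinearMap.mul' k (U P) ((S.rTensor (U P)) (Coalgebra.comul a)) =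
    algebraMap k (U P) (Coalgebra.counit a) := by
  induction a using induction with
  | hs c => simp [Algebra.TensorProduct.algebraMap_apply, S_algebraMap]
  | hE i => simp
  | hK i => simp [Kinv_mul_K]
  | hKinv i => simp [K_mul_Kinv]
  | hadd a b ha hb => simp [ha, hb]
  | hmul a b ha hb =>
    rw [Bialgebra.comul_mul, Bialgebra.counit_mul, map_mul (algebraMap k (U P)), ← hb]
    generalize Coalgebra.comul (R := k) b = t
    induction t with
    | zero => simp
    | tmul x y =>
      rw [S_left_mul, ha, ← Algebra.commutes, mul_assoc]
      simp
    | add x y hx hy => simp only [mul_add, map_add, hx, hy]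

theorem S_right (a : U P) : LinearMap.mul' k (U P) ((S.lTensor (U P)) (Coalgebra.comul a)) =
    algebraMap k (U P) (Coalgebra.counit a) := by
  induction a using induction with
  | hs c => simp [Algebra.TensorProduct.algebraMap_apply]
  | hE i => simp [← mul_assoc, K_mul_Kinv]
  | hK i => simp [K_mul_Kinv]
  | hKinv i => simp [Kinv_mul_K]
  | hadd a b ha hb => simp [ha, hb]
  | hmul a b ha hb =>
    rw [Bialgebra.comul_mul, Bialgebra.counit_mul, mul_comm, map_mul (algebraMap k (U P)), ← ha]
    generalize Coalgebra.comul (R := k) a = t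
    induction t with
    | zero => simp
    | tmul x y =>
      rw [S_right_mul, hb, ← Algebra.commutes, mul_assoc]
      simp
    | add x y hx hy => simp only [add_mul, mul_add, map_add, hx, hy]

variable (P) in
instance : HopfAlgebra k (U P) where
  antipode := S
  mul_antipode_rTensor_comul := LinearMap.ext S_left
  mul_antipode_lTensor_comul := LinearMap.ext S_right

end U

/-! ### Yetter-Drinfel'd modules -/

section YetterDrinfeld

variable {H : Type v} [Ring H] [HopfAlgebra k H]

section Compat

variable {V : Type w} [AddCommGroup V] [Module k V]

/-- `h₁ ⊗ h₂ ↦ (m ⊗ a ↦ h₁ • m ⊗ h₂ a)`. -/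
def ydLeft (act : H →ₐ[k] Module.End k V) : H ⊗[k] H →ₗ[k] Module.End k (V ⊗[k] H) :=
  TensorProduct.homTensorHomMap (RingHom.id k) V H V H ∘ₗ
    TensorProduct.map act.toLinearMap (LinearMap.mul k H)

/-- `h₁ ⊗ h₂ ↦ (m ↦ (h₂ • m)₀ ⊗ (h₂ • m)₁ h₁)`. -/
def ydRight (act : H →ₐ[k] Module.End k V) (coact : V →ₗ[k] V ⊗[k] H) :
    H ⊗[k] H →ₗ[k] V →ₗ[k] V ⊗[k] H :=
  TensorProduct.lift (LinearMap.mk₂ k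
    (fun a b => LinearMap.lTensor V (LinearMap.mulRight k a) ∘ₗ coact ∘ₗ act b)
    (fun a a' b => by
      have : LinearMap.mulRight k (a + a') = LinearMap.mulRight k a + LinearMap.mulRight k a' := by
        ext; simp [mul_add]
      rw [this, LinearMap.lTensor_add, LinearMap.add_comp])
    (fun c a b => by
      have : LinearMap.mulRight k (c • a) = c • LinearMap.mulRight k a := by
        ext; simp
      rw [this, LinearMap.lTensor_smul, LinearMap.smul_comp])
    (fun a b b' => by rw [map_add, LinearMap.comp_add, LinearMap.comp_add])
    (fun c a b => by rw [map_smul, LinearMap.comp_smul, LinearMap.comp_smul]))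

@[simp] theorem ydLeft_tmul (act : H →ₐ[k] Module.End k V) (a b : H) (v : V) (c : H) :
    ydLeft act (a ⊗ₜ b) (v ⊗ₜ c) = act a v ⊗ₜ (b * c) := by
  simp [ydLeft]

theorem ydLeft_tmul' (act : H →ₐ[k] Module.End k V) (a b : H) :
    ydLeft act (a ⊗ₜ b) = TensorProduct.map (act a) (LinearMap.mulLeft k b) := by
  ext; simp

@[simp] theorem ydRight_tmul (act : H →ₐ[k] Module.End k V) (coact : V →ₗ[k] V ⊗[k] H)
    (a b : H) (v : V) : ydRight act coact (a ⊗ₜ b) v =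
      LinearMap.lTensor V (LinearMap.mulRight k a) (coact (act b v)) := by
  simp [ydRight]

theorem ydLeft_mul (act : H →ₐ[k] Module.End k V) (s t : H ⊗[k] H) :
    ydLeft act (s * t) = ydLeft act s * ydLeft act t := by
  induction s with
  | zero => simp
  | add x y hx hy => simp [add_mul, hx, hy]
  | tmul a b =>
    induction t with
    | zero => simp
    | add x y hx hy => simp [mul_add, hx, hy]
    | tmul c d => ext; simp [mul_assoc]

theorem compat_mul (act : H →ₐ[k] Module.End k V) (coact : V →ₗ[k] V ⊗[k] H) (g h : H)
    (hg : ∀ v, ydLeft act (Coalgebra.comul g) (coact v) =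
      ydRight act coact (Coalgebra.comul g) v)
    (hh : ∀ v, ydLeft act (Coalgebra.comul h) (coact v) =
      ydRight act coact (Coalgebra.comul h) v) (v : V) :
    ydLeft act (Coalgebra.comul (g * h)) (coact v) =
      ydRight act coact (Coalgebra.comul (g * h)) v := by
  rw [Bialgebra.comul_mul, ydLeft_mul, Module.End.mul_apply, hh]
  generalize Coalgebra.comul (R := k) h = t
  induction t with
  | zero => simp
  | add x y hx hy => simp only [map_add, mul_add, LinearMap.add_apply, hx, hy]
  | tmul c d =>
    have key : ∀ (s : H ⊗[k] H) (x : V ⊗[k] H),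
        ydLeft act s (LinearMap.lTensor V (LinearMap.mulRight k c) x) =
          LinearMap.lTensor V (LinearMap.mulRight k c) (ydLeft act s x) := by
      intro s x
      induction s with
      | zero => simp
      | add s s' h h' => simp only [map_add, LinearMap.add_apply, h, h']
      | tmul a b =>
        induction x with
        | zero => simp
        | add x y h h' => simp only [map_add, h, h']
        | tmul x y => simp [mul_assoc]
    rw [ydRight_tmul, key, hg]
    generalize Coalgebra.comul (R := k) g = s
    induction s with
    | zero => simp
    | add x y hx hy => simp only [map_add, add_mul, LinearMap.add_apply, hx, hy]
    | tmul a b =>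
      rw [ydRight_tmul, Algebra.TensorProduct.tmul_mul_tmul, ydRight_tmul, map_mul,
        Module.End.mul_apply, ← LinearMap.comp_apply, ← LinearMap.lTensor_comp]
      congr 2
      ext
      simp [mul_assoc]

end Compat

variable (k H) in
/-- A (left-right) Yetter-Drinfel'd module over the Hopf algebra `H`: a left module (given by its
representation `act`), a right comodule (with coaction `coact`), such that
`h₁ • m₀ ⊗ h₂ m₁ = (h₂ • m)₀ ⊗ (h₂ • m)₁ h₁`. -/
structure YDModule where
  V : Type w
  [addCommGroup : AddCommGroup V]
  [module : Module k V]
  act : H →ₐ[k] Module.End k V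
  coact : V →ₗ[k] V ⊗[k] H
  coassoc : ∀ v, TensorProduct.assoc k V H H (coact.rTensor H (coact v)) =
    (Coalgebra.comul (R := k) (A := H)).lTensor V (coact v)
  counit_coact : ∀ v, TensorProduct.rid k V
    ((Coalgebra.counit (R := k) (A := H)).lTensor V (coact v)) = v
  compat : ∀ h v, ydLeft act (Coalgebra.comul h) (coact v) =
    ydRight act coact (Coalgebra.comul h) v

namespace YDModule

attribute [instance] YDModule.addCommGroup YDModule.module

/-- Two Yetter-Drinfel'd modules are isomorphic if there is a bijective map which is both
`H`-linear and `H`-colinear. -/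
def Isomorphic (M N : YDModule.{u, v, w} k H) : Prop :=
  ∃ f : M.V ≃ₗ[k] N.V, (∀ h v, f (M.act h v) = N.act h (f v)) ∧
    ∀ v, N.coact (f v) = f.toLinearMap.rTensor H (M.coact v)

theorem isomorphic_equivalence : Equivalence (Isomorphic (k := k) (H := H)) where
  refl M := ⟨LinearEquiv.refl k M.V, fun _ _ => rfl, fun v => by simp⟩
  symm := by
    rintro M N ⟨f, h1, h2⟩
    refine ⟨f.symm, fun h v => ?_, fun v => ?_⟩
    · rw [LinearEquiv.symm_apply_eq, h1, LinearEquiv.apply_symm_apply]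
    · have := h2 (f.symm v)
      rw [LinearEquiv.apply_symm_apply] at this
      rw [this, ← LinearMap.comp_apply, ← LinearMap.rTensor_comp]
      simp
  trans := by
    rintro M N L ⟨f, h1, h2⟩ ⟨g, h3, h4⟩
    refine ⟨f.trans g, fun h v => ?_, fun v => ?_⟩
    · simp [h1, h3]
    · simp only [LinearEquiv.trans_apply, h4, h2, LinearEquiv.coe_trans, LinearMap.rTensor_comp,
        LinearMap.comp_apply]

variable (k H) in
/-- Isomorphism of Yetter-Drinfel'd modules as a setoid. -/
def isoSetoid : Setoid (YDModule.{u, v, w} k H) := ⟨Isomorphic, isomorphic_equivalence⟩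

variable (k H) in
/-- Isomorphism classes of Yetter-Drinfel'd modules. -/
def IsoClass := Quotient (isoSetoid.{u, v, w} k H)

/-- The isomorphism class `[M]`. -/
def isoClass (M : YDModule.{u, v, w} k H) : IsoClass.{u, v, w} k H := Quotient.mk _ M

/-- The image of `W ⊗ H` in `V ⊗ H`, for a subspace `W` of `V`. -/
def subTensor {V : Type w} [AddCommGroup V] [Module k V] (W : Submodule k V) :
    Submodule k (V ⊗[k] H) := LinearMap.range (W.subtype.rTensor H)

/-- `W` is a Yetter-Drinfel'd submodule: an `H`-submodule and an `H`-subcomodule. -/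
structure IsSub (M : YDModule.{u, v, w} k H) (W : Submodule k M.V) : Prop where
  act_mem : ∀ h, ∀ v ∈ W, M.act h v ∈ W
  coact_mem : ∀ v ∈ W, M.coact v ∈ subTensor (H := H) W

/-- A Yetter-Drinfel'd module is simple if it is nonzero and has no non-trivial
Yetter-Drinfel'd submodules. -/
def IsSimple (M : YDModule.{u, v, w} k H) : Prop :=
  Nontrivial M.V ∧ ∀ W : Submodule k M.V, M.IsSub W → W = ⊥ ∨ W = ⊤

theorem map_mem_subTensor {V : Type w} [AddCommGroup V] [Module k V] {W : Submodule k V}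
    {f : V →ₗ[k] V} (hf : ∀ v ∈ W, f v ∈ W) (φ : H →ₗ[k] H) {x : V ⊗[k] H}
    (hx : x ∈ subTensor (H := H) W) : TensorProduct.map f φ x ∈ subTensor (H := H) W := by
  obtain ⟨y, rfl⟩ := hx
  refine ⟨TensorProduct.map (f.restrict hf) φ y, ?_⟩
  rw [← LinearMap.comp_apply, ← LinearMap.comp_apply]
  congr 1
  ext
  simp

section Sub

variable (M : YDModule.{u, v, w} k H) {W : Submodule k M.V} (hW : M.IsSub W)

theorem subtype_rTensor_injective {V : Type w} [AddCommGroup V] [Module k V] (W : Submodule k V)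
    (X : Type v) [AddCommGroup X] [Module k X] : Function.Injective (W.subtype.rTensor X) :=
  Module.Flat.rTensor_preserves_injective_linearMap _ W.injective_subtype

/-- The restricted coaction `W → W ⊗ H`. -/
def subCoact : W →ₗ[k] W ⊗[k] H :=
  (LinearEquiv.ofInjective _ (subtype_rTensor_injective W H)).symm.toLinearMap ∘ₗ
    (M.coact ∘ₗ W.subtype).codRestrict (subTensor (H := H) W) fun w => hW.coact_mem _ w.2

theorem subCoact_spec (w : W) : W.subtype.rTensor H (M.subCoact hW w) = M.coact w := by
  have := LinearEquiv.apply_symm_apply (LinearEquiv.ofInjective _ (subtype_rTensor_injective W H))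
    ((M.coact ∘ₗ W.subtype).codRestrict (subTensor (H := H) W) (fun w => hW.coact_mem _ w.2) w)
  exact congrArg Subtype.val this

theorem subCoact_spec' : W.subtype.rTensor H ∘ₗ M.subCoact hW = M.coact ∘ₗ W.subtype :=
  LinearMap.ext (M.subCoact_spec hW)

/-- The restricted action on `W`. -/
def subAct : H →ₐ[k] Module.End k W where
  toFun h := (M.act h).restrict (hW.act_mem h)
  map_one' := by ext; simp
  map_mul' a b := by ext; simp
  map_zero' := by ext; simp
  map_add' a b := by ext; simp
  commutes' c := by ext; simp

@[simp] theorem coe_subAct (h : H) (w : W) : (M.subAct hW h w : M.V) = M.act h w := rfl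

/-- A Yetter-Drinfel'd submodule as a Yetter-Drinfel'd module. -/
def sub : YDModule.{u, v, w} k H where
  V := W
  act := M.subAct hW
  coact := M.subCoact hW
  coassoc w := by
    apply subtype_rTensor_injective W (H ⊗[k] H)
    have n1 : ∀ y : (W ⊗[k] H) ⊗[k] H,
        W.subtype.rTensor (H ⊗[k] H) (TensorProduct.assoc k W H H y) =
          TensorProduct.assoc k M.V H H ((W.subtype.rTensor H).rTensor H y) := by
      intro y
      rw [← LinearEquiv.coe_coe, ← LinearEquiv.coe_coe, ← LinearMap.comp_apply,
        ← LinearMap.comp_apply]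
      congr 1
      ext
      simp
    have n2 : ∀ y : W ⊗[k] H, W.subtype.rTensor (H ⊗[k] H)
        ((Coalgebra.comul (R := k) (A := H)).lTensor W y) =
          (Coalgebra.comul (R := k) (A := H)).lTensor M.V (W.subtype.rTensor H y) := by
      intro y
      rw [← LinearMap.comp_apply, ← LinearMap.comp_apply, LinearMap.lTensor_comp_rTensor,
        LinearMap.rTensor_comp_lTensor]
    rw [n1, n2, subCoact_spec, ← LinearMap.comp_apply (LinearMap.rTensor H _),
      ← LinearMap.rTensor_comp, subCoact_spec', LinearMap.rTensor_comp, LinearMap.comp_apply,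
      subCoact_spec, M.coassoc]
  counit_coact w := by
    apply Subtype.ext
    have n : ∀ y : W ⊗[k] H, ((TensorProduct.rid k W
        ((Coalgebra.counit (R := k) (A := H)).lTensor W y) : W) : M.V) = TensorProduct.rid k M.V
        ((Coalgebra.counit (R := k) (A := H)).lTensor M.V (W.subtype.rTensor H y)) := by
      intro y
      induction y with
      | zero => simp
      | tmul a b => simp
      | add a b ha hb => simp only [map_add, Submodule.coe_add, ha, hb]
    rw [n, subCoact_spec, M.counit_coact]
  compat h w := by
    apply subtype_rTensor_injective W H
    have n1 : ∀ (t : H ⊗[k] H) (y : W ⊗[k] H), W.subtype.rTensor H (ydLeft (M.subAct hW) t y) =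
        ydLeft M.act t (W.subtype.rTensor H y) := by
      intro t y
      induction t with
      | zero => simp
      | add a b ha hb => simp only [map_add, LinearMap.add_apply, ha, hb]
      | tmul a b =>
        induction y with
        | zero => simp
        | add a b ha hb => simp only [map_add, ha, hb]
        | tmul x y => simp
    have n2 : ∀ (t : H ⊗[k] H), W.subtype.rTensor H
        (ydRight (M.subAct hW) (M.subCoact hW) t w) = ydRight M.act M.coact t w := by
      intro t
      induction t with
      | zero => simp
      | add a b ha hb => simp only [map_add, LinearMap.add_apply, ha, hb]
      | tmul a b =>
        rw [ydRight_tmul, ydRight_tmul, ← coe_subAct M hW, ← M.subCoact_spec hW,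
          ← LinearMap.comp_apply (LinearMap.rTensor H _),
          ← LinearMap.comp_apply (LinearMap.lTensor M.V _), LinearMap.lTensor_comp_rTensor,
          LinearMap.rTensor_comp_lTensor]
    rw [n1, n2, subCoact_spec, M.compat]

end Sub

end YDModule

end YetterDrinfeld

/-! ### Group-likes of the finite dual -/

section FiniteDual

variable (k) (H : Type v) [Ring H] [Algebra k H]

/-- The finite dual `H°`: linear functionals on `H` vanishing on some two-sided ideal of finite
codimension. -/
def finiteDual : Set (Module.Dual k H) :=
  {f | ∃ I : Ideal H, I.IsTwoSided ∧ FiniteDimensional k (H ⧸ I) ∧ ∀ x ∈ I, f x = 0}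

/-- The group-like elements `𝒢(H°)`. The coalgebra structure of `H°` is dual to the algebra
structure of `H`: the counit is `f ↦ f 1`, and the comultiplication sends `f` to the element of
`H° ⊗ H° ⊆ (H ⊗ H)^*` given by `x ⊗ y ↦ f (x y)`. So `f` is group-like if `f 1 = 1`
and `f ∘ mul = f ⊗ f`. -/
structure FiniteDualGroupLike where
  val : Module.Dual k H
  mem : val ∈ finiteDual k H
  counit_eq_one : val 1 = 1
  comul_eq : val ∘ₗ LinearMap.mul' k H = TensorProduct.dualDistrib k H H (val ⊗ₜ val)

variable {k H}

theorem FiniteDualGroupLike.map_mul (f : FiniteDualGroupLike k H) (a b : H) :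
    f.val (a * b) = f.val a * f.val b := by
  simpa using LinearMap.congr_fun f.comul_eq (a ⊗ₜ b)

/-- A group-like element of `H°` is an algebra map `H → k`. -/
def FiniteDualGroupLike.toAlgHom (f : FiniteDualGroupLike k H) : H →ₐ[k] k :=
  AlgHom.ofLinearMap f.val f.counit_eq_one f.map_mul

end FiniteDual

/-! ### The Yetter-Drinfel'd modules `(U^{≥0})_{β,g}` -/

namespace U

variable {P : QuantumDatum k ι}

/-- The action `h ·_β a = β(h₂) h₃ a S⁻¹(h₁)` of `U^{≥0}` on itself: it is the composite of
`h ↦ h₁ ⊗ (h₂ ⊗ h₃)`, of `h₁ ⊗ (h₂ ⊗ h₃) ↦ S⁻¹(h₁) ⊗ β(h₂) h₃`, and of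
`x ⊗ y ↦ (a ↦ y a x)`. -/
def betaAct (β : U P →ₐ[k] k) : U P →ₐ[k] Module.End k (U P) :=
  (AlgHom.mulLeftRight k (U P)).comp <|
    (Algebra.TensorProduct.comm k (U P)ᵐᵒᵖ (U P)).toAlgHom.comp <|
      (Algebra.TensorProduct.map antipodeInvHom
        ((Algebra.TensorProduct.lid k (U P)).toAlgHom.comp
          (Algebra.TensorProduct.map β (AlgHom.id k (U P))))).comp <|
        (Algebra.TensorProduct.map (AlgHom.id k (U P)) (Bialgebra.comulAlgHom k (U P))).comp
          (Bialgebra.comulAlgHom k (U P))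

/-- The formula `h ·_β a = ∑ β(h₂) h₃ a S⁻¹(h₁)`. -/
theorem betaAct_apply (β : U P →ₐ[k] k) (h a : U P) {X : Type w} (s : Finset X)
    (x y z : X → U P) (hs : (Coalgebra.comul (R := k) (A := U P)).lTensor (U P)
      (Coalgebra.comul h) = ∑ i ∈ s, x i ⊗ₜ[k] (y i ⊗ₜ[k] z i)) :
    betaAct β h a = ∑ i ∈ s, β (y i) • (z i * a * Sinv (x i)) := by
  have : betaAct β h = (AlgHom.mulLeftRight k (U P)) ((Algebra.TensorProduct.comm k _ _)
      ((Algebra.TensorProduct.map antipodeInvHom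
        ((Algebra.TensorProduct.lid k (U P)).toAlgHom.comp
          (Algebra.TensorProduct.map β (AlgHom.id k (U P)))))
            ((Coalgebra.comul (R := k) (A := U P)).lTensor (U P) (Coalgebra.comul h)))) := rfl
  rw [this, hs]
  simp [map_sum, LinearMap.sum_apply, Sinv_apply]

@[simp] theorem betaAct_K (β : U P →ₐ[k] k) (i : ι) (a : U P) :
    betaAct β (K P i) a = β (K P i) • (K P i * a * Kinv P i) := by
  simpa using betaAct_apply β (K P i) a (Finset.univ : Finset Unit) (fun _ => K P i)
    (fun _ => K P i) (fun _ => K P i) (by simp)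

@[simp] theorem betaAct_Kinv (β : U P →ₐ[k] k) (i : ι) (a : U P) :
    betaAct β (Kinv P i) a = β (Kinv P i) • (Kinv P i * a * K P i) := by
  simpa using betaAct_apply β (Kinv P i) a (Finset.univ : Finset Unit) (fun _ => Kinv P i)
    (fun _ => Kinv P i) (fun _ => Kinv P i) (by simp)

@[simp] theorem betaAct_E (β : U P →ₐ[k] k) (i : ι) (a : U P) :
    betaAct β (E P i) a = -(a * (E P i * Kinv P i)) + β (E P i) • (a * Kinv P i) +
      β (K P i) • (E P i * a * Kinv P i) := by
  have := betaAct_apply β (E P i) a (Finset.univ : Finset (Fin 3)) ![E P i, K P i, K P i]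
    ![1, E P i, K P i] ![1, 1, E P i]
    (by simp [Fin.sum_univ_three, TensorProduct.tmul_add, Algebra.TensorProduct.one_def,
      add_assoc])
  rw [this]
  simp [Fin.sum_univ_three]

/-- The Yetter-Drinfel'd module `(U^{≥0})_β = (U^{≥0}, ·_β, Δ)`. -/
def beta (β : U P →ₐ[k] k) : YDModule.{u, max u v, max u v} k (U P) where
  V := U P
  act := betaAct β
  coact := Coalgebra.comul
  coassoc v := Coalgebra.coassoc_apply v
  counit_coact v := by simp
  compat h := by
    induction h using induction with
    | hs c =>
      intro v
      have : Coalgebra.comul (R := k) (algebraMap k (U P) c) = c • ((1 : U P) ⊗ₜ 1) := by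
        rw [Bialgebra.comul_algebraMap, Algebra.algebraMap_eq_smul_one,
          Algebra.TensorProduct.one_def]
      rw [this, map_smul, map_smul, LinearMap.smul_apply, LinearMap.smul_apply, ydLeft_tmul',
        ydRight_tmul]
      simp [Module.End.one_eq_id]
    | hE i =>
      intro v
      have e : Coalgebra.comul (R := k) (betaAct β (E P i) v) =
          -(Coalgebra.comul v * ((E P i ⊗ₜ 1 + K P i ⊗ₜ E P i) * (Kinv P i ⊗ₜ Kinv P i))) +
          β (E P i) • (Coalgebra.comul v * (Kinv P i ⊗ₜ Kinv P i)) +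
          β (K P i) • ((E P i ⊗ₜ 1 + K P i ⊗ₜ E P i) * Coalgebra.comul v *
            (Kinv P i ⊗ₜ[k] Kinv P i)) := by
        rw [betaAct_E]
        simp only [map_add, map_neg, map_smul, Bialgebra.comul_mul, comul_E, comul_Kinv]
      rw [comul_E, map_add, map_add, LinearMap.add_apply, LinearMap.add_apply, ydRight_tmul,
        ydRight_tmul, e]
      simp only [map_one, Module.End.one_apply]
      generalize Coalgebra.comul (R := k) v = t
      induction t with
      | zero => simp
      | add x y hx hy =>
        simp only [map_add, map_neg, map_smul, mul_add, add_mul, smul_add, neg_add] at hx hy ⊢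
        refine Eq.trans ?_ ((congrArg₂ (· + ·) hx hy).trans ?_) <;> abel
      | tmul x y =>
        simp only [ydLeft_tmul, betaAct_E, betaAct_K, add_mul, mul_add,
          Algebra.TensorProduct.tmul_mul_tmul, map_add, map_neg,
          LinearMap.lTensor_tmul, LinearMap.mulRight_apply, one_mul, mul_one, mul_assoc,
          Kinv_mul_K, K_mul_Kinv, TensorProduct.add_tmul, TensorProduct.neg_tmul,
          TensorProduct.smul_tmul', smul_add]
        abel
    | hK i =>
      intro v
      rw [comul_K, ydRight_tmul, betaAct_K, map_smul, Bialgebra.comul_mul, Bialgebra.comul_mul,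
        comul_K, comul_Kinv]
      generalize Coalgebra.comul (R := k) v = t
      induction t with
      | zero => simp
      | add x y hx hy => simp only [map_add, mul_add, add_mul, smul_add, hx, hy]
      | tmul x y =>
        simp [mul_assoc, Kinv_mul_K, TensorProduct.smul_tmul']
    | hKinv i =>
      intro v
      rw [comul_Kinv, ydRight_tmul, betaAct_Kinv, map_smul, Bialgebra.comul_mul,
        Bialgebra.comul_mul, comul_K, comul_Kinv]
      generalize Coalgebra.comul (R := k) v = t
      induction t with
      | zero => simp
      | add x y hx hy => simp only [map_add, mul_add, add_mul, smul_add, hx, hy]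
      | tmul x y =>
        simp [mul_assoc, K_mul_Kinv, TensorProduct.smul_tmul']
    | hadd a b ha hb => intro v; simp only [map_add, LinearMap.add_apply, ha, hb]
    | hmul a b ha hb => exact compat_mul _ _ a b ha hb

/-- In a Yetter-Drinfel'd module, the part of a submodule with coaction in `W ⊗ U^{≥0}` is stable
under the action. -/
theorem coact_act_mem (M : YDModule.{u, max u v, w} k (U P)) {W : Submodule k M.V}
    (hW : ∀ h, ∀ v ∈ W, M.act h v ∈ W) (h : U P) :
    ∀ v ∈ W, M.coact v ∈ YDModule.subTensor (H := U P) W →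
      M.coact (M.act h v) ∈ YDModule.subTensor (H := U P) W := by
  have mulR : ∀ (c : U P) (x : M.V ⊗[k] U P), x ∈ YDModule.subTensor (H := U P) W →
      LinearMap.lTensor M.V (LinearMap.mulRight k c) x ∈ YDModule.subTensor (H := U P) W :=
    fun c x hx => YDModule.map_mem_subTensor (f := LinearMap.id) (fun v hv => hv) _ hx
  have cancel : ∀ (c d : U P), c * d = 1 → ∀ x : M.V ⊗[k] U P,
      LinearMap.lTensor M.V (LinearMap.mulRight k c) x ∈ YDModule.subTensor (H := U P) W →
      x ∈ YDModule.subTensor (H := U P) W := by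
    intro c d hcd x hx
    have := mulR d _ hx
    rw [← LinearMap.comp_apply, ← LinearMap.lTensor_comp] at this
    have e : LinearMap.mulRight k d ∘ₗ LinearMap.mulRight k c = LinearMap.id := by
      ext; simp [mul_assoc, hcd]
    rwa [e, LinearMap.lTensor_id, LinearMap.id_apply] at this
  induction h using induction with
  | hs c =>
    intro v hv hc
    have : M.act (algebraMap k (U P) c) v = c • v := by simp
    rw [this, map_smul]
    exact Submodule.smul_mem _ _ hc
  | hE i =>
    intro v hv hc
    have := M.compat (E P i) v
    rw [comul_E, map_add, map_add, LinearMap.add_apply, LinearMap.add_apply, ydRight_tmul,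
      ydRight_tmul, ydLeft_tmul', ydLeft_tmul', map_one, Module.End.one_apply,
      ← sub_eq_iff_eq_add'] at this
    apply cancel (K P i) (Kinv P i) (K_mul_Kinv i)
    rw [← this]
    exact Submodule.sub_mem _ (Submodule.add_mem _ (YDModule.map_mem_subTensor (hW _) _ hc)
      (YDModule.map_mem_subTensor (hW _) _ hc)) (mulR _ _ hc)
  | hK i =>
    intro v hv hc
    have := M.compat (K P i) v
    rw [comul_K, ydRight_tmul, ydLeft_tmul'] at this
    apply cancel (K P i) (Kinv P i) (K_mul_Kinv i)
    rw [← this]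
    exact YDModule.map_mem_subTensor (hW _) _ hc
  | hKinv i =>
    intro v hv hc
    have := M.compat (Kinv P i) v
    rw [comul_Kinv, ydRight_tmul, ydLeft_tmul'] at this
    apply cancel (Kinv P i) (K P i) (Kinv_mul_K i)
    rw [← this]
    exact YDModule.map_mem_subTensor (hW _) _ hc
  | hadd a b ha hb =>
    intro v hv hc
    rw [map_add, LinearMap.add_apply, map_add]
    exact Submodule.add_mem _ (ha v hv hc) (hb v hv hc)
  | hmul a b ha hb =>
    intro v hv hc
    rw [map_mul, Module.End.mul_apply]
    exact ha _ (hW b v hv) (hb v hv hc)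

/-- The subspace `U^{≥0} ·_β g = {h ·_β g}` of `U^{≥0}`. -/
def betaOrbit (β : U P →ₐ[k] k) (g : U P) : Submodule k (U P) :=
  LinearMap.range ((betaAct β).toLinearMap.flip g)

theorem mem_betaOrbit (β : U P →ₐ[k] k) (g : U P) : g ∈ betaOrbit β g := by
  refine ⟨1, ?_⟩
  change betaAct β 1 g = g
  rw [map_one, Module.End.one_apply]

theorem betaOrbit_isSub (β : U P →ₐ[k] k) (g : GroupLike k (U P)) :
    (beta β).IsSub (betaOrbit β g) := by
  have hact : ∀ h, ∀ v ∈ betaOrbit β (g : U P), (beta β).act h v ∈ betaOrbit β (g : U P) := by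
    rintro h _ ⟨a, rfl⟩
    refine ⟨h * a, ?_⟩
    change betaAct β (h * a) g = betaAct β h (betaAct β a g)
    rw [map_mul, Module.End.mul_apply]
  refine ⟨hact, ?_⟩
  rintro _ ⟨a, rfl⟩
  have hg : (g : U P) ∈ betaOrbit β (g : U P) := mem_betaOrbit β g
  refine coact_act_mem (beta β) hact a _ hg ?_
  have key : Coalgebra.comul (R := k) (g : U P) ∈
      YDModule.subTensor (H := U P) (V := U P) (betaOrbit β (g : U P)) := by
    rw [g.2.comul_eq_tmul_self]
    exact ⟨TensorProduct.tmul k (⟨g, hg⟩ : ↥(betaOrbit β (g : U P))) (g : U P), rfl⟩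
  exact key

/-- The Yetter-Drinfel'd module `(U^{≥0})_{β,g} = U^{≥0} ·_β g ⊆ (U^{≥0})_β`. -/
def betaG (β : U P →ₐ[k] k) (g : GroupLike k (U P)) : YDModule.{u, max u v, max u v} k (U P) :=
  (beta β).sub (betaOrbit_isSub β g)

/-- The map `Φ(β, g) = [(U^{≥0})_{β,g}]`. -/
def Phi (x : FiniteDualGroupLike k (U P) × GroupLike k (U P)) :
    YDModule.IsoClass.{u, max u v, max u v} k (U P) :=
  YDModule.isoClass (betaG x.1.toAlgHom x.2)

/-- The weight space `M_(σ) = {v | K_i v = σ_i v for all i}`. -/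
def weightSpace (M : YDModule.{u, max u v, w} k (U P)) (σ : ι → kˣ) : Submodule k M.V where
  carrier := {v | ∀ i, M.act (K P i) v = (σ i : k) • v}
  zero_mem' i := by simp
  add_mem' ha hb i := by rw [map_add, ha i, hb i, smul_add]
  smul_mem' c a ha i := by rw [map_smul, ha i, smul_comm]

open Classical in
/-- A weight module is the direct sum of its weight spaces. -/
def IsWeight (M : YDModule.{u, max u v, w} k (U P)) : Prop :=
  DirectSum.IsInternal (weightSpace M)

variable (P) in
/-- The set of isomorphism classes of simple Yetter-Drinfel'd `U^{≥0}`-modules which are weight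
modules. -/
def simpleWeightClasses : Set (YDModule.IsoClass.{u, max u v, max u v} k (U P)) :=
  {c | ∃ M : YDModule.{u, max u v, max u v} k (U P),
    M.IsSimple ∧ IsWeight M ∧ YDModule.isoClass M = c}

/-- `K_i` as a group-like element. -/
def groupLikeK (i : ι) : GroupLike k (U P) := ⟨K P i, counit_K i, comul_K i⟩

theorem groupLikeK_comm (i j : ι) :
    Commute (groupLikeK (P := P) i) (groupLikeK (P := P) j) :=
  GroupLike.val_injective (K_comm i j)

/-- `K_λ = ∏ K_i ^ {t_i}` for `λ = ∑ t_i α_i`. -/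
def Klam [Fintype ι] (t : ι → ℤ) : GroupLike k (U P) :=
  Finset.univ.noncommProd (fun i => groupLikeK (P := P) i ^ t i)
    fun i _ j _ _ => (groupLikeK_comm i j).zpow_zpow _ _

/-- The weight `(β(K_1), …, β(K_n))` of an element `β` of `𝒢((U^{≥0})°)`. -/
def weightOf (β : FiniteDualGroupLike k (U P)) (i : ι) : kˣ where
  val := β.val (K P i)
  inv := β.val (Kinv P i)
  val_inv := by rw [← β.map_mul, K_mul_Kinv, β.counit_eq_one]
  inv_val := by rw [← β.map_mul, Kinv_mul_K, β.counit_eq_one]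

end U

end HalfQuantum

end

/-!
The proof rests on three facts about `U = U^{≥0}`.

*Characters.* A character `χ` of `U` kills every `E_i`, since `K_i E_i K_i⁻¹ = q_i² E_i` and
`q_i² ≠ 1`, so it is given by arbitrary values `χ(K_i) ≠ 0`. As `q` is not a root of unity,
characters separate the elements `K_λ` (`Klam_eq_of_char`).

*Pointedness.* Let `F_n` be spanned by the monomials with at most `n` factors `E_i`. Then
`Δ(F_{n+1}) ⊆ F_{n+1} ⊗ F_0 + F_n ⊗ U`, so a functional vanishing on `F_0` lowers the filtration
degree of an element of a right comodule. An element of minimal degree therefore has its coaction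
in `V ⊗ F_0`; as `F_0` has the basis `K_λ` of group-like elements, a nonzero comodule contains some
`x ≠ 0` with coaction `x ⊗ K_λ` (`exists_coact_eq_Klam`). For the one-dimensional comodule given by
a group-like element `g` this says `g = K_λ`.

*Cofreeness of `U_β`.* A linear map `f : M → k_β` on a Yetter-Drinfel'd module gives the map
`v ↦ f(v_0) v_1` of Yetter-Drinfel'd modules `M → U_β` (`cofreeMap_act`, `comul_cofreeMap`).

For every character `χ` one has `χ(h ·_β a) = β(h) χ(a)`. If a group-like element `g'` lies in
`U_{β,g}`, then evaluating at the counit and at all `χ` gives `g' = g`. Pointedness now shows that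
`U_{β,g}` is simple. An isomorphism `U_{β,g} ≅ U_{γ,g'}` sends `g` to an element with coaction
`w ⊗ g`, which is a multiple of `g'`; so `g = g'`, and comparing the action of the `K_i` gives
`β = γ`.

Conversely let `M` be a simple weight module. The space of all `v` with coaction `v ⊗ K_λ` is stable
under the `K_i`, and nonzero for some `λ`, so it contains a weight vector `m`, of weight `σ`, and
`M = U m`. Because the Cartan matrix is invertible, weights have a height which each `E_i` raises by
the same positive amount; hence `M` is `k m` plus weight spaces of larger height, and there is a
linear map `f : M → k_β` with `f(m) ≠ 0`, where `β(K_i) = σ_i` (`exists_linear_to_char`). The map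
`M → U_β` defined by `f` is injective with image `U ·_β K_λ` (`isomorphic_betaG`).
-/

open scoped TensorProduct

noncomputable section

namespace HalfQuantum

universe u v w

variable {k : Type u} [Field k] {ι : Type v}

namespace U

variable {P : QuantumDatum k ι}

/-! ### Characters -/

theorem char_K_mul_Kinv (χ : U P →ₐ[k] k) (i : ι) : χ (K P i) * χ (Kinv P i) = 1 := by
  rw [← map_mul, K_mul_Kinv, map_one]

/-- A character kills `E_i`, because `K_i E_i K_i⁻¹ = q_i² E_i` with `q_i² ≠ 1`. -/
@[simp] theorem char_E (χ : U P →ₐ[k] k) (i : ι) : χ (E P i) = 0 := by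
  have h := congrArg χ (K_mul_E (P := P) i i)
  have hK : χ (K P i) ≠ 0 := left_ne_zero_of_mul_eq_one (char_K_mul_Kinv χ i)
  rw [map_smul, map_mul, map_mul, smul_eq_mul, mul_comm (χ (E P i)), qi_diag] at h
  by_contra hE
  exact qi_generic i 2 two_pos (mul_right_cancel₀ (mul_ne_zero hK hE) (by rw [one_mul, ← h]))

theorem char_sat (σ : ι → kˣ) :
    Sat P (B := k) (fun _ => 0) (fun i => (σ i : k)) (fun i => ((σ i)⁻¹ : kˣ)) where
  K_comm i j := mul_comm _ _
  K_mul_Kinv i := by simp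
  Kinv_mul_K i := by simp
  K_mul_E i j := by simp
  serre i j hij := by simp [serreSum]

variable (P) in
/-- The character of `U^{≥0}` with `E_i ↦ 0` and `K_i ↦ σ_i`. -/
def char (σ : ι → kˣ) : U P →ₐ[k] k := lift (char_sat σ)

@[simp] theorem char_apply_K (σ : ι → kˣ) (i : ι) : char P σ (K P i) = σ i :=
  lift_K (char_sat σ) i

variable (P) in
/-- A character of `U^{≥0}` as a group-like element of the finite dual: it vanishes on its kernel,
which has codimension one. -/
def groupLikeChar (σ : ι → kˣ) : FiniteDualGroupLike k (U P) where
  val := (char P σ).toLinearMap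
  mem := by
    refine ⟨RingHom.ker (char P σ), inferInstance, ?_, fun x hx => hx⟩
    refine Module.Finite.of_injective
      (Ideal.Quotient.liftₐ _ (char P σ) (fun _ h => h)).toLinearMap ?_
    exact RingHom.kerLift_injective (char P σ).toRingHom
  counit_eq_one := map_one (char P σ)
  comul_eq := by ext; simp

theorem weightOf_bijective :
    Function.Bijective (weightOf : FiniteDualGroupLike k (U P) → ι → kˣ) := by
  refine ⟨fun β γ h => ?_, fun σ => ⟨groupLikeChar P σ, ?_⟩⟩
  · have : β.toAlgHom = γ.toAlgHom := by
      refine hom_ext (fun i => by rw [char_E, char_E]) fun i => ?_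
      exact congrArg Units.val (congrFun h i)
    have hv : β.val = γ.val := LinearMap.ext fun a => DFunLike.congr_fun this a
    cases β; cases γ; cases hv; rfl
  · funext i
    exact Units.ext (char_apply_K σ i)

/-! ### The group-like elements `K_λ` -/

/-- A character restricted to the group-like elements. -/
def charUnits (χ : U P →ₐ[k] k) : GroupLike k (U P) →* kˣ :=
  MonoidHom.toHomUnits
    { toFun := fun g => χ g.val
      map_one' := by rw [GroupLike.val_one, map_one]
      map_mul' := fun g h => by rw [GroupLike.val_mul, map_mul] }

theorem pairwise_commute_zpowersHom : Pairwise fun i j : ι => ∀ x y : Multiplicative ℤ,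
    Commute (zpowersHom _ (groupLikeK (P := P) i) x) (zpowersHom _ (groupLikeK (P := P) j) y) :=
  fun i j _ _ _ => (groupLikeK_comm i j).zpow_zpow _ _

section Klam

variable [Fintype ι]

variable (P) in
/-- The group homomorphism `λ ↦ K_λ`. -/
def KlamHom : (ι → Multiplicative ℤ) →* GroupLike k (U P) :=
  MonoidHom.noncommPiCoprod (fun i => zpowersHom _ (groupLikeK (P := P) i))
    pairwise_commute_zpowersHom

theorem Klam_eq_KlamHom (t : ι → ℤ) :
    Klam (P := P) t = KlamHom P fun i => Multiplicative.ofAdd (t i) := rfl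

theorem Klam_zero : Klam (P := P) 0 = 1 := map_one (KlamHom P)

theorem Klam_add (s t : ι → ℤ) : Klam (P := P) (s + t) = Klam s * Klam t :=
  map_mul (KlamHom P) _ _

theorem Klam_single [DecidableEq ι] (i : ι) (n : ℤ) :
    Klam (P := P) (Pi.single i n) = groupLikeK i ^ n := by
  rw [Klam_eq_KlamHom]
  have : (fun j => Multiplicative.ofAdd ((Pi.single i n : ι → ℤ) j)) =
      Pi.mulSingle i (Multiplicative.ofAdd n) := by
    funext j
    obtain rfl | h := eq_or_ne j i
    · simp
    · simp [h]
  rw [this, KlamHom, MonoidHom.noncommPiCoprod_mulSingle]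
  rfl

theorem coe_Klam_add (s t : ι → ℤ) :
    (Klam (P := P) (s + t)).val = (Klam (P := P) s).val * (Klam (P := P) t).val := by
  rw [Klam_add, GroupLike.val_mul]

theorem K_eq_Klam [DecidableEq ι] (i : ι) : K P i = (Klam (P := P) (Pi.single i 1)).val := by
  rw [Klam_single, zpow_one]; rfl

theorem Kinv_eq_Klam [DecidableEq ι] (i : ι) :
    Kinv P i = (Klam (P := P) (Pi.single i (-1))).val := by
  rw [Klam_single, zpow_neg_one, GroupLike.val_inv]
  exact (S_K i).symm

theorem commute_K_Klam (i : ι) (t : ι → ℤ) : Commute (K P i) (Klam (P := P) t).val := by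
  classical
  rw [K_eq_Klam, Commute, SemiconjBy, ← coe_Klam_add, add_comm, coe_Klam_add]

theorem charUnits_Klam (χ : U P →ₐ[k] k) (t : ι → ℤ) :
    charUnits χ (Klam t) = ∏ i, charUnits χ (groupLikeK i) ^ t i := by
  refine (Finset.map_noncommProd _ _ _ (charUnits χ)).trans ?_
  rw [Finset.noncommProd_eq_prod]
  simp only [map_zpow]

/-- The characters of `U^{≥0}` separate the elements `K_λ`. -/
theorem Klam_eq_of_char {s t : ι → ℤ}
    (h : ∀ χ : U P →ₐ[k] k, χ (Klam (P := P) s).val = χ (Klam (P := P) t).val) : s = t := by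
  classical
  funext i
  -- The character with `K_i ↦ q` and `K_j ↦ 1` for `j ≠ i` sends `K_λ` to `q ^ t_i`.
  set Q := Units.mk0 P.q P.q_ne_zero
  set χ := char P (Pi.mulSingle i Q)
  have hχ : ∀ t : ι → ℤ, charUnits χ (Klam t) = Q ^ t i := by
    intro t
    have hK : ∀ j, charUnits χ (groupLikeK j) = (Pi.mulSingle i Q : ι → kˣ) j :=
      fun j => Units.ext (char_apply_K _ j)
    simp only [charUnits_Klam, hK]
    rw [Finset.prod_eq_single i (fun j _ hj => by rw [Pi.mulSingle_eq_of_ne hj, one_zpow])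
      (by simp), Pi.mulSingle_eq_same]
  have h1 : Q ^ s i = Q ^ t i := by
    rw [← hχ, ← hχ]
    exact Units.ext (h χ)
  refine injective_zpow_iff_not_isOfFinOrder.mpr (fun hQ => ?_) h1
  obtain ⟨n, hn, hQn⟩ := isOfFinOrder_iff_pow_eq_one.mp hQ
  exact P.q_generic n hn (by simpa [Q] using congrArg Units.val hQn)

theorem Klam_injective : Function.Injective (Klam : (ι → ℤ) → GroupLike k (U P)) :=
  fun s t h => Klam_eq_of_char fun χ => by rw [h]

end Klam

end U

/-! ### Subspaces of tensor products -/

section Tensor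

variable {B : Type v} [Ring B] [Algebra k B]

variable (k) in
/-- The image of `X ⊗ Y` in `B ⊗ B`, for subspaces `X` and `Y` of `B`. -/
abbrev tens (X Y : Submodule k B) : Submodule k (B ⊗[k] B) :=
  Submodule.map₂ (TensorProduct.mk k B B) X Y

theorem tens_mul_le (X Y X' Y' : Submodule k B) :
    tens k X Y * tens k X' Y' ≤ tens k (X * X') (Y * Y') := by
  rw [tens, tens, Submodule.map₂_eq_span_image2, Submodule.map₂_eq_span_image2,
    Submodule.span_mul_span, Submodule.span_le]
  rintro _ ⟨_, ⟨x, hx, y, hy, rfl⟩, _, ⟨x', hx', y', hy', rfl⟩, rfl⟩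
  simp only [TensorProduct.mk_apply, Algebra.TensorProduct.tmul_mul_tmul]
  exact Submodule.apply_mem_map₂ _ (Submodule.mul_mem_mul hx hx') (Submodule.mul_mem_mul hy hy')

variable {V : Type w} [AddCommGroup V] [Module k V]

theorem eq_zero_of_forall_coord {W κ : Type*} [AddCommGroup W] [Module k W]
    (b : Module.Basis κ k W) (z : V ⊗[k] W) (h : ∀ i, (b.coord i).lTensor V z = 0) : z = 0 := by
  classical
  apply (TensorProduct.equivFinsuppOfBasisRight b).injective
  ext i
  rw [TensorProduct.equivFinsuppOfBasisRight_apply, h, map_zero, map_zero, Finsupp.zero_apply]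

/-- A tensor in `V ⊗ B` on which all functionals vanishing on `A` vanish lies in `V ⊗ A`. -/
theorem mem_range_lTensor_of_forall_dual (A : Submodule k B) (z : V ⊗[k] B)
    (h : ∀ φ : Module.Dual k B, (∀ a ∈ A, φ a = 0) → φ.lTensor V z = 0) :
    z ∈ LinearMap.range (A.subtype.lTensor V) := by
  have hex : Function.Exact (A.subtype.lTensor V) (A.mkQ.lTensor V) :=
    lTensor_exact V (LinearMap.exact_subtype_mkQ A) A.mkQ_surjective
  refine (hex z).mp ?_
  let b := Module.Basis.ofVectorSpace k (B ⧸ A)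
  refine eq_zero_of_forall_coord b _ fun i => ?_
  rw [← LinearMap.comp_apply, ← LinearMap.lTensor_comp]
  exact h (b.coord i ∘ₗ A.mkQ) fun a ha => by simp [(Submodule.Quotient.mk_eq_zero A).mpr ha]

end Tensor

namespace U

variable {P : QuantumDatum k ι} [Fintype ι]

/-! ### The coradical filtration -/

variable (P) in
/-- The span of the `K_λ`. -/
def cartan : Submodule k (U P) := Submodule.span k (Set.range fun t => (Klam (P := P) t).val)

theorem Klam_mem_cartan (t : ι → ℤ) : (Klam (P := P) t).val ∈ cartan P :=
  Submodule.subset_span ⟨t, rfl⟩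

theorem one_mem_cartan : (1 : U P) ∈ cartan P := by
  have := Klam_mem_cartan (P := P) 0
  rwa [Klam_zero, GroupLike.val_one] at this

theorem K_mem_cartan (i : ι) : K P i ∈ cartan P := by
  classical
  rw [K_eq_Klam]; exact Klam_mem_cartan _

theorem Kinv_mem_cartan (i : ι) : Kinv P i ∈ cartan P := by
  classical
  rw [Kinv_eq_Klam]; exact Klam_mem_cartan _

theorem cartan_mul_cartan : cartan P * cartan P = cartan P := by
  refine le_antisymm ?_ fun x hx => ?_
  · rw [cartan, Submodule.span_mul_span, Submodule.span_le]
    rintro _ ⟨_, ⟨s, rfl⟩, _, ⟨t, rfl⟩, rfl⟩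
    simp only [← coe_Klam_add]
    exact Klam_mem_cartan _
  · rw [← mul_one x]
    exact Submodule.mul_mem_mul hx one_mem_cartan

variable (P) in
/-- The subspace `A + ∑ E_i A`, where `A` is the span of the `K_λ`. -/
def degOne : Submodule k (U P) := (1 ⊔ Submodule.span k (Set.range (E P))) * cartan P

theorem cartan_le_degOne : cartan P ≤ degOne P := fun x hx => by
  rw [← one_mul x]
  exact Submodule.mul_mem_mul (Submodule.mem_sup_left (Submodule.one_le.mp le_rfl)) hx

theorem E_mem_degOne (i : ι) : E P i ∈ degOne P := by
  rw [← mul_one (E P i)]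
  exact Submodule.mul_mem_mul (Submodule.mem_sup_right (Submodule.subset_span ⟨i, rfl⟩))
    one_mem_cartan

variable (P) in
/-- The filtration of `U^{≥0}` by the number of factors `E_i`. -/
def filt (n : ℕ) : Submodule k (U P) := cartan P * degOne P ^ n

@[simp] theorem filt_zero : filt P 0 = cartan P := by rw [filt, pow_zero, mul_one]

theorem filt_succ (n : ℕ) : filt P (n + 1) = filt P n * degOne P := by
  rw [filt, filt, pow_succ, mul_assoc]

theorem filt_mul_cartan (n : ℕ) : filt P n * cartan P = filt P n := by
  cases n with
  | zero => rw [filt_zero, cartan_mul_cartan]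
  | succ n => rw [filt_succ, mul_assoc, degOne, mul_assoc, cartan_mul_cartan]

theorem filt_mul_filt (m n : ℕ) : filt P m * filt P n = filt P (m + n) := by
  rw [filt.eq_1 P n, ← mul_assoc, filt_mul_cartan, filt, filt, mul_assoc, pow_add]

theorem filt_mono : Monotone (filt P) := monotone_nat_of_le_succ fun n => by
  calc filt P n = filt P n * cartan P := (filt_mul_cartan n).symm
    _ ≤ filt P n * degOne P := mul_le_mul' le_rfl cartan_le_degOne
    _ = filt P (n + 1) := (filt_succ n).symm

theorem exists_mem_filt (u : U P) : ∃ n, u ∈ filt P n := by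
  induction u using induction with
  | hs c =>
    refine ⟨0, ?_⟩
    rw [filt_zero, Algebra.algebraMap_eq_smul_one]
    exact Submodule.smul_mem _ _ one_mem_cartan
  | hE i =>
    refine ⟨1, ?_⟩
    rw [filt_succ, filt_zero, ← one_mul (E P i)]
    exact Submodule.mul_mem_mul one_mem_cartan (E_mem_degOne i)
  | hK i => exact ⟨0, by rw [filt_zero]; exact K_mem_cartan i⟩
  | hKinv i => exact ⟨0, by rw [filt_zero]; exact Kinv_mem_cartan i⟩
  | hadd a b ha hb =>
    obtain ⟨m, hm⟩ := ha
    obtain ⟨n, hn⟩ := hb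
    exact ⟨max m n, Submodule.add_mem _ (filt_mono (le_max_left m n) hm)
      (filt_mono (le_max_right m n) hn)⟩
  | hmul a b ha hb =>
    obtain ⟨m, hm⟩ := ha
    obtain ⟨n, hn⟩ := hb
    exact ⟨m + n, filt_mul_filt (P := P) m n ▸ Submodule.mul_mem_mul hm hn⟩

theorem map_comul_cartan_le :
    (cartan P).map (Bialgebra.comulAlgHom k (U P)).toLinearMap ≤ tens k (cartan P) (cartan P) := by
  rw [cartan, Submodule.map_span, Submodule.span_le]
  rintro _ ⟨_, ⟨t, rfl⟩, rfl⟩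
  have : Bialgebra.comulAlgHom k (U P) (Klam (P := P) t).val = _ :=
    (Klam (P := P) t).2.comul_eq_tmul_self
  simp only [AlgHom.toLinearMap_apply, this]
  exact Submodule.apply_mem_map₂ _ (Klam_mem_cartan t) (Klam_mem_cartan t)

theorem map_comul_degOne_le :
    (degOne P).map (Bialgebra.comulAlgHom k (U P)).toLinearMap ≤
      tens k (degOne P) (cartan P) ⊔ tens k (cartan P) ⊤ := by
  have hE : (1 ⊔ Submodule.span k (Set.range (E P))).map
      (Bialgebra.comulAlgHom k (U P)).toLinearMap ≤
      tens k (1 ⊔ Submodule.span k (Set.range (E P))) 1 ⊔ tens k (cartan P) ⊤ := by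
    rw [Submodule.map_sup, sup_le_iff, Submodule.map_span, Submodule.span_le,
      Submodule.one_eq_span, Submodule.map_span, Submodule.span_le]
    constructor
    · rintro _ ⟨_, rfl, rfl⟩
      refine Submodule.mem_sup_left ?_
      simp only [AlgHom.toLinearMap_apply, map_one, Algebra.TensorProduct.one_def]
      exact Submodule.apply_mem_map₂ _
        (Submodule.mem_sup_left (Submodule.mem_span_singleton_self _))
        (Submodule.mem_span_singleton_self _)
    · rintro _ ⟨_, ⟨i, rfl⟩, rfl⟩
      have : Bialgebra.comulAlgHom k (U P) (E P i) = _ := comul_E i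
      simp only [AlgHom.toLinearMap_apply, this]
      refine Submodule.add_mem_sup ?_ ?_
      · exact Submodule.apply_mem_map₂ _ (Submodule.mem_sup_right (Submodule.subset_span ⟨i, rfl⟩))
          (Submodule.mem_span_singleton_self _)
      · exact Submodule.apply_mem_map₂ _ (K_mem_cartan i) Submodule.mem_top
  rw [degOne, Submodule.map_mul]
  refine (mul_le_mul' hE map_comul_cartan_le).trans ?_
  rw [Submodule.sup_mul]
  refine sup_le_sup ((tens_mul_le _ _ _ _).trans ?_) ((tens_mul_le _ _ _ _).trans ?_)
  · rw [one_mul]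
  · rw [cartan_mul_cartan]
    exact Submodule.map₂_le_map₂_right le_top

/-- `Δ(F_{n+1}) ⊆ F_{n+1} ⊗ F_0 + F_n ⊗ U^{≥0}`, a weak form of the compatibility of the filtration
with the comultiplication. -/
theorem map_comul_filt_succ_le (n : ℕ) :
    (filt P (n + 1)).map (Bialgebra.comulAlgHom k (U P)).toLinearMap ≤
      tens k (filt P (n + 1)) (cartan P) ⊔ tens k (filt P n) ⊤ := by
  induction n with
  | zero =>
    rw [filt_succ, Submodule.map_mul, filt_zero]
    refine (mul_le_mul' map_comul_cartan_le map_comul_degOne_le).trans ?_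
    rw [Submodule.mul_sup]
    refine sup_le_sup ((tens_mul_le _ _ _ _).trans ?_) ((tens_mul_le _ _ _ _).trans ?_)
    · rw [cartan_mul_cartan]
    · rw [cartan_mul_cartan]
      exact Submodule.map₂_le_map₂_right le_top
  | succ n ih =>
    rw [filt_succ (n + 1), Submodule.map_mul]
    refine (mul_le_mul' ih map_comul_degOne_le).trans ?_
    rw [Submodule.mul_sup, Submodule.sup_mul, Submodule.sup_mul]
    refine sup_le (sup_le ?_ ?_) (sup_le ?_ ?_) <;> refine (tens_mul_le _ _ _ _).trans ?_
    · rw [cartan_mul_cartan]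
      exact le_sup_left
    · rw [← filt_succ]
      exact le_sup_of_le_right (Submodule.map₂_le_map₂_right le_top)
    · rw [filt_mul_cartan]
      exact le_sup_of_le_right (Submodule.map₂_le_map₂_right le_top)
    · rw [filt_mul_cartan]
      exact le_sup_of_le_right (Submodule.map₂_le_map₂ (filt_mono n.le_succ) le_top)

/-! ### Comodules -/

/-- The map `a ↦ φ(a_2) a_1` of `U^{≥0}`, for a functional `φ`. -/
def slice (φ : Module.Dual k (U P)) : U P →ₗ[k] U P :=
  TensorProduct.rid k (U P) ∘ₗ φ.lTensor (U P) ∘ₗ Coalgebra.comul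

theorem slice_mem_filt {φ : Module.Dual k (U P)} (hφ : ∀ a ∈ cartan P, φ a = 0) {n : ℕ} {a : U P}
    (ha : a ∈ filt P (n + 1)) : slice φ a ∈ filt P n := by
  have h := map_comul_filt_succ_le n (Submodule.mem_map_of_mem ha)
  suffices H : tens k (filt P (n + 1)) (cartan P) ⊔ tens k (filt P n) ⊤ ≤
      (filt P n).comap ((TensorProduct.rid k (U P)).toLinearMap ∘ₗ φ.lTensor (U P)) from H h
  refine sup_le ?_ ?_ <;> rw [tens, Submodule.map₂_le] <;> intro x hx y hy
  · simp [hφ y hy]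
  · simpa using Submodule.smul_mem _ _ hx

theorem slice_Klam (φ : Module.Dual k (U P)) (t : ι → ℤ) :
    slice φ (Klam (P := P) t).val = φ (Klam (P := P) t).val • (Klam (P := P) t).val := by
  have : Coalgebra.comul (R := k) (Klam (P := P) t).val = _ :=
    (Klam (P := P) t).2.comul_eq_tmul_self
  simp [slice, this]

section Comodule

variable {V : Type w} [AddCommGroup V] [Module k V] {ρ : V →ₗ[k] V ⊗[k] U P}

/-- The functional `φ` acts on a right comodule by `x ↦ φ(x_1) x_0`. -/
def dualAct (ρ : V →ₗ[k] V ⊗[k] U P) (φ : Module.Dual k (U P)) : V →ₗ[k] V :=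
  TensorProduct.rid k V ∘ₗ φ.lTensor V ∘ₗ ρ

omit [Fintype ι] in
theorem coact_dualAct (hρ : ∀ v, TensorProduct.assoc k V (U P) (U P) (ρ.rTensor (U P) (ρ v)) =
      (Coalgebra.comul (R := k) (A := U P)).lTensor V (ρ v)) (φ : Module.Dual k (U P)) (x : V) :
    ρ (dualAct ρ φ x) = (slice φ).lTensor V (ρ x) := by
  have h1 : ∀ z : V ⊗[k] U P, ρ (TensorProduct.rid k V (φ.lTensor V z)) =
      (TensorProduct.rid k (U P) ∘ₗ φ.lTensor (U P)).lTensor V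
        (TensorProduct.assoc k V (U P) (U P) (ρ.rTensor (U P) z)) := by
    intro z
    induction z with
    | zero => simp
    | add x y hx hy => simp only [map_add, hx, hy]
    | tmul x y =>
      simp only [LinearMap.lTensor_tmul, TensorProduct.rid_tmul, map_smul, LinearMap.rTensor_tmul]
      generalize ρ x = z
      induction z with
      | zero => simp
      | add x y hx hy => simp only [map_add, smul_add, TensorProduct.add_tmul, hx, hy]
      | tmul x y => simp
  rw [dualAct, LinearMap.comp_apply, LinearMap.comp_apply, LinearEquiv.coe_coe, h1, hρ,
    ← LinearMap.comp_apply, ← LinearMap.lTensor_comp]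
  rfl

omit [Fintype ι] in
theorem coact_injective (hε : ∀ v, TensorProduct.rid k V
      ((Coalgebra.counit (R := k) (A := U P)).lTensor V (ρ v)) = v) : Function.Injective ρ :=
  fun x y h => by rw [← hε x, h, hε]

theorem exists_coact_mem_filt (x : V) :
    ∃ n, ρ x ∈ LinearMap.range ((filt P n).subtype.lTensor V) := by
  have mono : ∀ {m n}, m ≤ n → LinearMap.range ((filt P m).subtype.lTensor V) ≤
      LinearMap.range ((filt P n).subtype.lTensor V) := by
    rintro m n h _ ⟨y, rfl⟩
    refine ⟨(Submodule.inclusion (filt_mono h)).lTensor V y, ?_⟩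
    rw [← LinearMap.comp_apply, ← LinearMap.lTensor_comp]
    rfl
  generalize ρ x = z
  induction z with
  | zero => exact ⟨0, Submodule.zero_mem _⟩
  | add x y hx hy =>
    obtain ⟨m, hm⟩ := hx
    obtain ⟨n, hn⟩ := hy
    exact ⟨max m n, Submodule.add_mem _ (mono (le_max_left m n) hm) (mono (le_max_right m n) hn)⟩
  | tmul x y =>
    obtain ⟨n, hn⟩ := exists_mem_filt y
    exact ⟨n, x ⊗ₜ ⟨y, hn⟩, rfl⟩

/-- A nonzero right comodule has a nonzero element with coaction in the degree-zero part: an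
element of minimal filtration degree is one, since all functionals vanishing in degree zero lower
the filtration degree. -/
theorem exists_coact_mem_cartan [Nontrivial V]
    (hρ : ∀ v, TensorProduct.assoc k V (U P) (U P) (ρ.rTensor (U P) (ρ v)) =
      (Coalgebra.comul (R := k) (A := U P)).lTensor V (ρ v)) :
    ∃ x : V, x ≠ 0 ∧ ρ x ∈ LinearMap.range ((cartan P).subtype.lTensor V) := by
  classical
  have hex : ∃ n, ∃ x : V, x ≠ 0 ∧ ρ x ∈ LinearMap.range ((filt P n).subtype.lTensor V) := by
    obtain ⟨x, hx⟩ := exists_ne (0 : V)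
    obtain ⟨n, hn⟩ := exists_coact_mem_filt (ρ := ρ) x
    exact ⟨n, x, hx, hn⟩
  obtain ⟨x, hx, hxn⟩ := Nat.find_spec hex
  have hmin := fun m => Nat.find_min (m := m) hex
  generalize Nat.find hex = n at hxn hmin
  refine ⟨x, hx, ?_⟩
  cases n with
  | zero => rwa [filt_zero] at hxn
  | succ n =>
    refine mem_range_lTensor_of_forall_dual _ _ fun φ hφ => ?_
    have h0 : dualAct ρ φ x = 0 := by
      by_contra hne
      refine hmin n n.lt_succ_self ⟨_, hne, ?_⟩
      rw [coact_dualAct hρ]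
      obtain ⟨y, hy⟩ := hxn
      refine ⟨((slice φ).restrict (p := filt P (n + 1)) (q := filt P n)
        fun a ha => slice_mem_filt hφ ha).lTensor V y, ?_⟩
      rw [← hy, ← LinearMap.comp_apply, ← LinearMap.comp_apply, ← LinearMap.lTensor_comp,
        ← LinearMap.lTensor_comp]
      rfl
    exact (TensorProduct.rid k V).map_eq_zero_iff.mp h0

theorem linearIndependent_Klam :
    LinearIndependent k fun t : ι → ℤ => (Klam (P := P) t).val :=
  linearIndep_groupLikeVal.comp _ Klam_injective

/-- `U^{≥0}` is pointed with group-like elements `K_λ`: every nonzero right comodule has a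
one-dimensional subcomodule, with coefficient some `K_λ`. -/
theorem exists_coact_eq_Klam [Nontrivial V]
    (hρ : ∀ v, TensorProduct.assoc k V (U P) (U P) (ρ.rTensor (U P) (ρ v)) =
      (Coalgebra.comul (R := k) (A := U P)).lTensor V (ρ v))
    (hε : ∀ v, TensorProduct.rid k V
      ((Coalgebra.counit (R := k) (A := U P)).lTensor V (ρ v)) = v) :
    ∃ (x : V) (t : ι → ℤ), x ≠ 0 ∧ ρ x = x ⊗ₜ (Klam (P := P) t).val := by
  obtain ⟨x, hx, y, hy⟩ := exists_coact_mem_cartan hρ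
  let b : Module.Basis (ι → ℤ) k (cartan P) := Module.Basis.span linearIndependent_Klam
  have hb : ∀ t, (b t : U P) = (Klam (P := P) t).val :=
    fun t => congrArg Subtype.val (Module.Basis.span_apply linearIndependent_Klam t)
  obtain ⟨π, hπ⟩ := LinearMap.exists_leftInverse_of_injective (cartan P).subtype
    (Submodule.ker_subtype _)
  -- `δ t` is a functional with `δ_t(K_λ) = 1` if `λ = t` and `δ_t(K_λ) = 0` otherwise.
  let δ : (ι → ℤ) → Module.Dual k (U P) := fun t => b.coord t ∘ₗ π
  have hδ : ∀ t, δ t ∘ₗ (cartan P).subtype = b.coord t := fun t => by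
    rw [LinearMap.comp_assoc, hπ, LinearMap.comp_id]
  have hs : ∀ t, slice (δ t) ∘ₗ (cartan P).subtype =
      (b.coord t).smulRight (Klam (P := P) t).val := by
    intro t
    refine b.ext fun s => ?_
    have : δ t (b s) = b.coord t (b s) := LinearMap.congr_fun (hδ t) (b s)
    rw [LinearMap.comp_apply, Submodule.subtype_apply, hb, slice_Klam, ← hb, this,
      LinearMap.smulRight_apply]
    obtain rfl | h := eq_or_ne s t
    · rw [hb]
    · simp [h]
  have hd : ∀ t, dualAct ρ (δ t) x = TensorProduct.rid k V ((b.coord t).lTensor V y) := by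
    intro t
    rw [dualAct, LinearMap.comp_apply, LinearMap.comp_apply, ← hy, ← LinearMap.comp_apply
      (LinearMap.lTensor V _), ← LinearMap.lTensor_comp, hδ]
    rfl
  have key : ∀ t, ρ (dualAct ρ (δ t) x) = dualAct ρ (δ t) x ⊗ₜ (Klam (P := P) t).val := by
    intro t
    rw [coact_dualAct hρ, hd, ← hy, ← LinearMap.comp_apply, ← LinearMap.lTensor_comp, hs]
    generalize y = z
    induction z with
    | zero => simp
    | add x y hx hy => simp only [map_add, TensorProduct.add_tmul, hx, hy]
    | tmul v a => simp [TensorProduct.smul_tmul]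
  by_contra! hne
  have h0 : y = 0 := eq_zero_of_forall_coord b _ fun t => by
    by_contra h
    refine hne _ t ?_ (key t)
    rwa [hd, ne_eq, LinearEquiv.map_eq_zero_iff]
  exact hx (coact_injective hε (by rw [← hy, h0, map_zero, map_zero]))

end Comodule

theorem Klam_bijective : Function.Bijective (Klam : (ι → ℤ) → GroupLike k (U P)) := by
  refine ⟨Klam_injective, fun g => ?_⟩
  -- The comodule `k` with coaction `c ↦ c ⊗ g`.
  obtain ⟨x, t, hx, h⟩ := exists_coact_eq_Klam (P := P) (V := k)
    (ρ := (TensorProduct.mk k k (U P)).flip g.val)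
    (fun v => by
      have : Coalgebra.comul (R := k) g.val = _ := g.2.comul_eq_tmul_self
      simp [this])
    (fun v => by
      have : Coalgebra.counit (R := k) g.val = _ := g.2.counit_eq_one
      simp [this])
  refine ⟨t, GroupLike.val_injective ?_⟩
  have := congrArg (TensorProduct.lid k (U P)) h
  simp only [LinearMap.flip_apply, TensorProduct.mk_apply, TensorProduct.lid_tmul] at this
  exact (smul_right_injective _ hx this).symm

end U

namespace U

variable {P : QuantumDatum k ι}

/-! ### Weight modules -/

section Weight

variable (M : YDModule.{u, max u v, w} k (U P))

theorem act_K_act_E (i j : ι) (v : M.V) : M.act (K P i) (M.act (E P j) v) =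
    P.qi j ^ P.A j i • M.act (E P j) (M.act (K P i) v) := by
  rw [← Module.End.mul_apply, ← map_mul, K_mul_E, map_smul, map_mul]
  rfl

/-- `E_j` shifts weights by `α_j`. -/
theorem act_E_mem_weightSpace {σ : ι → kˣ} (j : ι) {v : M.V} (hv : v ∈ weightSpace M σ) :
    M.act (E P j) v ∈ weightSpace M
      (fun i => Units.mk0 (P.qi j ^ P.A j i) (zpow_ne_zero _ (qi_ne_zero j)) * σ i) := by
  intro i
  rw [act_K_act_E, hv i, map_smul, smul_smul]
  rfl

theorem act_Kinv_of_act_K {i : ι} {c : kˣ} {v : M.V} (hv : M.act (K P i) v = (c : k) • v) :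
    M.act (Kinv P i) v = ((c⁻¹ : kˣ) : k) • v := by
  calc M.act (Kinv P i) v = ((c⁻¹ : kˣ) : k) • M.act (Kinv P i) (M.act (K P i) v) := by
        rw [hv, map_smul, smul_smul, Units.inv_mul, one_smul]
    _ = _ := by
        rw [← Module.End.mul_apply, ← map_mul, Kinv_mul_K, map_one, Module.End.one_apply]

/-- A subspace stable under the generators is a submodule. -/
theorem act_mem_of_generators {W : Submodule k M.V} (hE : ∀ i, ∀ v ∈ W, M.act (E P i) v ∈ W)
    (hK : ∀ i, ∀ v ∈ W, M.act (K P i) v ∈ W) (hKinv : ∀ i, ∀ v ∈ W, M.act (Kinv P i) v ∈ W)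
    (h : U P) : ∀ v ∈ W, M.act h v ∈ W := by
  induction h using induction with
  | hs c => intro v hv; simpa using Submodule.smul_mem _ _ hv
  | hE i => exact hE i
  | hK i => exact hK i
  | hKinv i => exact hKinv i
  | hadd a b ha hb =>
    intro v hv
    rw [map_add, LinearMap.add_apply]
    exact Submodule.add_mem _ (ha v hv) (hb v hv)
  | hmul a b ha hb =>
    intro v hv
    rw [map_mul, Module.End.mul_apply]
    exact ha _ (hb v hv)

theorem iSupIndep_weightSpace : iSupIndep (weightSpace M) := by
  have h := Module.End.independent_iInf_maxGenEigenspace_of_forall_mapsTo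
    (fun i => M.act (K P i)) (fun i j φ => Module.End.mapsTo_maxGenEigenspace_of_comm (by
      rw [Commute, SemiconjBy, ← map_mul, ← map_mul, K_comm]) φ)
  refine (h.comp (f := fun (σ : ι → kˣ) i => (σ i : k)) fun σ τ hστ => ?_).mono fun σ v hv => ?_
  · funext i
    exact Units.ext (congrFun hστ i)
  · refine (Submodule.mem_iInf _).mpr fun i => ?_
    exact Module.End.mem_maxGenEigenspace _ _ _ |>.mpr ⟨1, by simp [hv i]⟩

/-- A module generated by a weight vector is a weight module. -/
theorem isWeight_of_generated {σ : ι → kˣ} {m : M.V} (hm : m ∈ weightSpace M σ)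
    (hgen : ∀ v, ∃ h, M.act h m = v) : IsWeight M := by
  classical
  refine DirectSum.isInternal_submodule_of_iSupIndep_of_iSup_eq_top (iSupIndep_weightSpace M) ?_
  refine eq_top_iff.mpr fun v _ => ?_
  obtain ⟨h, rfl⟩ := hgen v
  have stable : ∀ (f : Module.End k M.V), (∀ σ, ∀ v ∈ weightSpace M σ,
      f v ∈ ⨆ σ, weightSpace M σ) → ∀ v ∈ ⨆ σ, weightSpace M σ, f v ∈ ⨆ σ, weightSpace M σ :=
    fun f hf => (iSup_le hf : (⨆ σ, weightSpace M σ) ≤ (⨆ σ, weightSpace M σ).comap f)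
  refine act_mem_of_generators M (fun i => stable _ fun σ v hv => ?_)
    (fun i => stable _ fun σ v hv => ?_) (fun i => stable _ fun σ v hv => ?_) h m
    (Submodule.mem_iSup_of_mem σ hm)
  · exact Submodule.mem_iSup_of_mem _ (act_E_mem_weightSpace M i hv)
  · rw [hv i]
    exact Submodule.smul_mem _ _ (Submodule.mem_iSup_of_mem σ hv)
  · rw [act_Kinv_of_act_K M (hv i)]
    exact Submodule.smul_mem _ _ (Submodule.mem_iSup_of_mem σ hv)

end Weight

/-! ### The modules `(U^{≥0})_{β,g}` -/

/-- Under a character, `h ·_β a` becomes multiplication by `β(h)`: the terms that contain `E_i`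
vanish, and conjugation by `K_i` has no effect. -/
theorem char_betaAct (χ β : U P →ₐ[k] k) (h a : U P) : χ (betaAct β h a) = β h * χ a := by
  induction h using induction generalizing a with
  | hs c => simp
  | hE i => simp
  | hK i =>
    have := char_K_mul_Kinv χ i
    rw [betaAct_K, map_smul, map_mul, map_mul, mul_right_comm, this, one_mul, smul_eq_mul]
  | hKinv i =>
    have := char_K_mul_Kinv χ i
    rw [betaAct_Kinv, map_smul, map_mul, map_mul, mul_right_comm, mul_comm (χ (Kinv P i)), this,
      one_mul, smul_eq_mul]
  | hadd a b ha hb => rw [map_add, LinearMap.add_apply, map_add, ha, hb, map_add, add_mul]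
  | hmul a b ha hb => rw [map_mul, Module.End.mul_apply, ha, hb, map_mul, mul_assoc]

section betaG

variable [Fintype ι] (β : U P →ₐ[k] k) (g : GroupLike k (U P))

/-- The only group-like element of `(U^{≥0})_{β,g}` is `g`, since characters separate the
group-like elements. -/
theorem eq_of_mem_betaOrbit {g' : GroupLike k (U P)} (h : g'.val ∈ betaOrbit β g.val) :
    g' = g := by
  obtain ⟨s, rfl⟩ := Klam_bijective.2 g
  obtain ⟨t, rfl⟩ := Klam_bijective.2 g'
  obtain ⟨a, ha⟩ := h
  have key : ∀ χ : U P →ₐ[k] k, χ (Klam t).val = β a * χ (Klam s).val := fun χ => by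
    rw [← char_betaAct, ← ha]; rfl
  -- Evaluating at the counit gives `β a = 1`.
  have h1 : β a = 1 := by
    have := key (Bialgebra.counitAlgHom k (U P))
    rw [Bialgebra.counitAlgHom_apply, Bialgebra.counitAlgHom_apply,
      (Klam t).2.counit_eq_one, (Klam s).2.counit_eq_one, mul_one] at this
    exact this.symm
  rw [Klam_eq_of_char fun χ => (by rw [key, h1, one_mul] : χ (Klam t).val = χ (Klam s).val)]

omit [Fintype ι] in
theorem eq_smul_of_comul {a g : U P} (h : Coalgebra.comul (R := k) a = a ⊗ₜ g) :
    a = Coalgebra.counit (R := k) a • g := by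
  have := congrArg (TensorProduct.lid k (U P) ∘ (Coalgebra.counit (R := k)).rTensor (U P)) h
  simpa using this

/-- The generator `g` of `(U^{≥0})_{β,g}`. -/
def betaGen : (betaG β g).V := (⟨g.val, mem_betaOrbit β g.val⟩ : betaOrbit β g.val)

omit [Fintype ι] in
theorem betaG_coact_coe (w : (betaG β g).V) :
    (betaOrbit β g.val).subtype.rTensor (U P) ((betaG β g).coact w) =
      Coalgebra.comul (R := k) ((betaOrbit β g.val).subtype w) :=
  YDModule.subCoact_spec _ (betaOrbit_isSub β g) w

omit [Fintype ι] in
theorem betaG_act_betaGen (w : (betaG β g).V) : ∃ h, (betaG β g).act h (betaGen β g) = w := by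
  obtain ⟨h, hh⟩ := w.2
  exact ⟨h, Subtype.ext hh⟩

omit [Fintype ι] in
theorem betaG_coact_betaGen :
    (betaG β g).coact (betaGen β g) = betaGen β g ⊗ₜ g.val := by
  apply YDModule.subtype_rTensor_injective (betaOrbit β g.val) (U P)
  exact (betaG_coact_coe β g _).trans g.2.comul_eq_tmul_self

theorem betaG_act_K_betaGen (i : ι) :
    (betaG β g).act (K P i) (betaGen β g) = β (K P i) • betaGen β g := by
  obtain ⟨t, rfl⟩ := Klam_bijective.2 g
  apply Subtype.ext
  refine (betaAct_K β i (Klam t).val).trans ?_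
  rw [(commute_K_Klam i t).eq, mul_assoc, K_mul_Kinv, mul_one]
  rfl

theorem isWeight_betaG (β : FiniteDualGroupLike k (U P)) : IsWeight (betaG β.toAlgHom g) :=
  isWeight_of_generated _ (σ := weightOf β) (fun i => betaG_act_K_betaGen β.toAlgHom g i)
    (betaG_act_betaGen β.toAlgHom g)

/-- An element of `(U^{≥0})_{β,g}` with coaction `w ↦ w ⊗ g'` is a multiple of the generator. -/
theorem eq_smul_betaGen {w : (betaG β g).V} (hw : w ≠ 0) {g' : GroupLike k (U P)}
    (h : (betaG β g).coact w = w ⊗ₜ g'.val) :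
    g' = g ∧ ∃ c : k, c ≠ 0 ∧ w = c • betaGen β g := by
  have h1 : Coalgebra.comul (R := k) ((betaOrbit β g.val).subtype w) =
      (betaOrbit β g.val).subtype w ⊗ₜ g'.val := by
    rw [← betaG_coact_coe, h]; rfl
  have h2 := eq_smul_of_comul h1
  set c := Coalgebra.counit (R := k) ((betaOrbit β g.val).subtype w)
  have hc : c ≠ 0 := fun hc => hw (Subtype.ext (h2.trans (by rw [hc, zero_smul]; rfl)))
  have hg : g' = g := by
    refine eq_of_mem_betaOrbit β g ?_
    have : g'.val = c⁻¹ • (betaOrbit β g.val).subtype w := by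
      rw [h2, smul_smul, inv_mul_cancel₀ hc, one_smul]
    rw [this]
    exact Submodule.smul_mem _ _ w.2
  subst hg
  exact ⟨rfl, c, hc, Subtype.ext h2⟩

omit [Fintype ι] in
theorem betaGen_ne_zero : betaGen β g ≠ 0 := fun h => by
  have h0 : g.val = 0 := congrArg Subtype.val h
  have h1 := g.2.counit_eq_one
  rw [h0, map_zero] at h1
  exact zero_ne_one h1

theorem exists_mem_coact_eq_Klam (M : YDModule.{u, max u v, w} k (U P)) {W : Submodule k M.V}
    (hW : M.IsSub W) (hbot : W ≠ ⊥) :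
    ∃ x ∈ W, ∃ t : ι → ℤ, x ≠ 0 ∧ M.coact x = x ⊗ₜ (Klam (P := P) t).val := by
  have : Nontrivial W := Submodule.nontrivial_iff_ne_bot.mpr hbot
  obtain ⟨x, t, hx, hxt⟩ : ∃ (x : W) (t : ι → ℤ), x ≠ 0 ∧
      M.subCoact hW x = x ⊗ₜ (Klam (P := P) t).val :=
    exists_coact_eq_Klam (M.sub hW).coassoc (M.sub hW).counit_coact
  refine ⟨x, x.2, t, fun h => hx (Subtype.ext h), ?_⟩
  rw [← M.subCoact_spec hW x, hxt]
  rfl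

/-- A nonzero submodule of `(U^{≥0})_{β,g}` contains a group-like element, hence `g`. -/
theorem isSimple_betaG : (betaG β g).IsSimple := by
  refine ⟨⟨_, _, betaGen_ne_zero β g⟩, fun W hW => or_iff_not_imp_left.mpr fun hbot => ?_⟩
  obtain ⟨x, hxW, t, hx, hxt⟩ := exists_mem_coact_eq_Klam _ hW hbot
  obtain ⟨-, c, hc, hxc⟩ := eq_smul_betaGen β g hx hxt
  have hgen : betaGen β g ∈ W := by
    have : betaGen β g = c⁻¹ • x := by rw [hxc, smul_smul, inv_mul_cancel₀ hc, one_smul]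
    rw [this]
    exact Submodule.smul_mem _ _ hxW
  refine eq_top_iff.mpr fun w _ => ?_
  obtain ⟨h, rfl⟩ := betaG_act_betaGen β g w
  exact hW.act_mem h _ hgen

end betaG

theorem Phi_injective [Fintype ι] : Function.Injective
    (Phi : FiniteDualGroupLike k (U P) × GroupLike k (U P) → _) := by
  rintro ⟨β, g⟩ ⟨γ, g'⟩ h
  obtain ⟨f, hact, hcoact⟩ : YDModule.Isomorphic (betaG β.toAlgHom g) (betaG γ.toAlgHom g') :=
    Quotient.exact h
  have hf : f (betaGen β.toAlgHom g) ≠ 0 := by simpa using betaGen_ne_zero β.toAlgHom g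
  obtain ⟨rfl, c, hc, hfc⟩ := eq_smul_betaGen γ.toAlgHom g' hf (g' := g) (by
    rw [hcoact, betaG_coact_betaGen]; rfl)
  refine Prod.ext (weightOf_bijective.1 ?_) rfl
  funext i
  refine Units.ext ?_
  have h1 := hact (K P i) (betaGen β.toAlgHom g)
  rw [betaG_act_K_betaGen, map_smul, hfc, map_smul, betaG_act_K_betaGen, smul_comm] at h1
  exact smul_left_injective k (betaGen_ne_zero γ.toAlgHom g) (smul_right_injective _ hc h1)

/-! ### Maps into the modules `(U^{≥0})_β` -/

section CofreeMap

variable {M : YDModule.{u, max u v, w} k (U P)} {β : U P →ₐ[k] k} {f : Module.Dual k M.V}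

/-- The colinear map `v ↦ f(v_0) v_1` from `M` to `U^{≥0}` defined by a functional `f`. -/
def cofreeMap (M : YDModule.{u, max u v, w} k (U P)) (f : Module.Dual k M.V) : M.V →ₗ[k] U P :=
  (TensorProduct.lid k (U P)).toLinearMap ∘ₗ f.rTensor (U P) ∘ₗ M.coact

theorem comul_cofreeMap (v : M.V) : Coalgebra.comul (R := k) (cofreeMap M f v) =
    (cofreeMap M f).rTensor (U P) (M.coact v) := by
  have h1 : ∀ z : M.V ⊗[k] U P, Coalgebra.comul (R := k)
      (TensorProduct.lid k (U P) (f.rTensor (U P) z)) =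
      ((TensorProduct.lid k (U P)).toLinearMap ∘ₗ f.rTensor (U P)).rTensor (U P)
        ((TensorProduct.assoc k M.V (U P) (U P)).symm
          ((Coalgebra.comul (R := k) (A := U P)).lTensor M.V z)) := by
    intro z
    induction z with
    | zero => simp
    | add x y hx hy => simp only [map_add, hx, hy]
    | tmul x y =>
      simp only [LinearMap.rTensor_tmul, TensorProduct.lid_tmul, map_smul, LinearMap.lTensor_tmul]
      generalize Coalgebra.comul (R := k) y = z
      induction z with
      | zero => simp
      | add x y hx hy => simp only [map_add, smul_add, TensorProduct.tmul_add, hx, hy]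
      | tmul x y => simp [TensorProduct.smul_tmul']
  rw [cofreeMap, LinearMap.comp_apply, LinearMap.comp_apply, LinearEquiv.coe_coe, h1,
    ← M.coassoc, LinearEquiv.symm_apply_apply, ← LinearMap.comp_apply, ← LinearMap.rTensor_comp]
  rfl

/-- If `f : M → k_β` is `U^{≥0}`-linear, then `v ↦ f(v_0) v_1` is a map of Yetter-Drinfel'd modules
`M → (U^{≥0})_β`. -/
theorem cofreeMap_act (hf : ∀ h v, f (M.act h v) = β h * f v) (h : U P) (v : M.V) :
    cofreeMap M f (M.act h v) = betaAct β h (cofreeMap M f v) := by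
  let T : M.V ⊗[k] U P →ₗ[k] U P := (TensorProduct.lid k (U P)).toLinearMap ∘ₗ f.rTensor (U P)
  have hl : ∀ a b z, T (ydLeft M.act (a ⊗ₜ b) z) = β a • (b * T z) := by
    intro a b z
    induction z with
    | zero => simp
    | add x y hx hy => simp only [map_add, mul_add, smul_add, hx, hy]
    | tmul x y => simp [T, hf, mul_smul]
  have hr : ∀ a z, T (LinearMap.lTensor M.V (LinearMap.mulRight k a) z) = T z * a := by
    intro a z
    induction z with
    | zero => simp
    | add x y hx hy => simp only [map_add, add_mul, hx, hy]
    | tmul x y => simp [T]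
  have hc : ∀ v, T (M.coact v) = cofreeMap M f v := fun _ => rfl
  induction h using induction generalizing v with
  | hs c => simp
  | hE i =>
    have := congrArg T (M.compat (E P i) v)
    rw [comul_E, map_add, map_add, LinearMap.add_apply, LinearMap.add_apply, ydRight_tmul,
      ydRight_tmul, map_add, map_add, hl, hl, hr, hr, map_one, Module.End.one_apply, hc, hc,
      char_E, zero_smul, zero_add] at this
    rw [betaAct_E, char_E, zero_smul, add_zero, ← smul_mul_assoc, this, add_mul, mul_assoc,
      mul_assoc, K_mul_Kinv, mul_one]
    abel
  | hK i =>
    have := congrArg T (M.compat (K P i) v)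
    rw [comul_K, ydRight_tmul, hl, hr, hc, hc] at this
    rw [betaAct_K, ← smul_mul_assoc, this, mul_assoc, K_mul_Kinv, mul_one]
  | hKinv i =>
    have := congrArg T (M.compat (Kinv P i) v)
    rw [comul_Kinv, ydRight_tmul, hl, hr, hc, hc] at this
    rw [betaAct_Kinv, ← smul_mul_assoc, this, mul_assoc, Kinv_mul_K, mul_one]
  | hadd a b ha hb =>
    rw [map_add, map_add, LinearMap.add_apply, LinearMap.add_apply, map_add, ha, hb]
  | hmul a b ha hb =>
    rw [map_mul, map_mul, Module.End.mul_apply, Module.End.mul_apply, ha, hb]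

theorem ker_cofreeMap_isSub (hf : ∀ h v, f (M.act h v) = β h * f v) :
    M.IsSub (LinearMap.ker (cofreeMap M f)) where
  act_mem h v hv := by
    rw [LinearMap.mem_ker] at hv ⊢
    rw [cofreeMap_act hf, hv, map_zero]
  coact_mem v hv := by
    have hex := Module.Flat.rTensor_exact (U P) (cofreeMap M f).exact_subtype_ker_map
    refine (hex _).mp ?_
    rw [← comul_cofreeMap, LinearMap.mem_ker.mp hv, map_zero]

theorem orbit_isSub {m : M.V} {g : U P} (hm : M.coact m = m ⊗ₜ g) :
    M.IsSub (LinearMap.range (M.act.toLinearMap.flip m)) := by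
  have hact : ∀ h, ∀ v ∈ LinearMap.range (M.act.toLinearMap.flip m),
      M.act h v ∈ LinearMap.range (M.act.toLinearMap.flip m) := by
    rintro h _ ⟨a, rfl⟩
    exact ⟨h * a, by simp⟩
  have hmem : m ∈ LinearMap.range (M.act.toLinearMap.flip m) := ⟨1, by simp⟩
  refine ⟨hact, ?_⟩
  rintro _ ⟨a, rfl⟩
  refine coact_act_mem M hact a m hmem ?_
  rw [hm]
  exact ⟨TensorProduct.tmul k (⟨m, hmem⟩ : LinearMap.range (M.act.toLinearMap.flip m)) g, rfl⟩

/-- A nonzero element `m` with coaction `m ⊗ g` generates a simple Yetter-Drinfel'd module already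
under the action. -/
theorem exists_act_eq (hM : M.IsSimple) {m : M.V} (hm0 : m ≠ 0) {g : U P}
    (hm : M.coact m = m ⊗ₜ g) (v : M.V) : ∃ h, M.act h m = v := by
  have horb : LinearMap.range (M.act.toLinearMap.flip m) = ⊤ := by
    refine (hM.2 _ (orbit_isSub hm)).resolve_left fun hbot => hm0 ?_
    have : m ∈ LinearMap.range (M.act.toLinearMap.flip m) := ⟨1, by simp⟩
    rwa [hbot, Submodule.mem_bot] at this
  exact LinearMap.range_eq_top.mp horb v

/-- A simple Yetter-Drinfel'd module that contains `m` with coaction `m ⊗ g`, and a linear map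
to `k_β` that does not kill `m`, is isomorphic to `(U^{≥0})_{β,g}`. -/
theorem isomorphic_betaG {M : YDModule.{u, max u v, max u v} k (U P)} {f : Module.Dual k M.V}
    (hM : M.IsSimple) {m : M.V} {g : GroupLike k (U P)}
    (hm : M.coact m = m ⊗ₜ g.val) (hf : ∀ h v, f (M.act h v) = β h * f v) (hfm : f m ≠ 0) :
    YDModule.Isomorphic (betaG β g) M := by
  have hm0 : m ≠ 0 := fun h => hfm (by rw [h, map_zero])
  have hFm : cofreeMap M f m = f m • g.val := by simp [cofreeMap, hm]
  have hg0 : g.val ≠ 0 := fun h => by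
    have h1 := g.2.counit_eq_one
    rw [h, map_zero] at h1
    exact zero_ne_one h1
  have hker : LinearMap.ker (cofreeMap M f) = ⊥ := by
    refine (hM.2 _ (ker_cofreeMap_isSub hf)).resolve_right fun htop => ?_
    have : m ∈ LinearMap.ker (cofreeMap M f) := htop ▸ Submodule.mem_top
    rw [LinearMap.mem_ker, hFm] at this
    exact smul_ne_zero hfm hg0 this
  have hact : ∀ h, cofreeMap M f (M.act h m) = f m • betaAct β h g.val := fun h => by
    rw [cofreeMap_act hf, hFm, map_smul]
  have hmem : ∀ v, cofreeMap M f v ∈ betaOrbit β g.val := by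
    intro v
    obtain ⟨h, rfl⟩ := exists_act_eq hM hm0 hm v
    exact (hact h).symm ▸ Submodule.smul_mem _ _ ⟨h, rfl⟩
  let F : M.V →ₗ[k] betaOrbit β g.val := (cofreeMap M f).codRestrict _ hmem
  have hF : Function.Bijective F := by
    refine ⟨fun x y h => LinearMap.ker_eq_bot.mp hker (congrArg Subtype.val h), ?_⟩
    rintro ⟨_, h, rfl⟩
    refine ⟨(f m)⁻¹ • M.act h m, Subtype.ext ?_⟩
    refine (map_smul (cofreeMap M f) _ _).trans ?_
    rw [hact, smul_smul, inv_mul_cancel₀ hfm, one_smul]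
    rfl
  refine YDModule.isomorphic_equivalence.symm
    (⟨LinearEquiv.ofBijective F hF, fun h v => ?_, fun v => ?_⟩ : YDModule.Isomorphic M (betaG β g))
  · exact Subtype.ext (cofreeMap_act hf h v)
  · apply YDModule.subtype_rTensor_injective (betaOrbit β g.val) (U P)
    refine (betaG_coact_coe β g (F v)).trans ((comul_cofreeMap v).trans ?_)
    exact LinearMap.congr_fun (LinearMap.rTensor_comp (U P) (betaOrbit β g.val).subtype F)
      (M.coact v)

end CofreeMap

/-! ### Classification of the simple weight modules -/

section Classification

variable (M : YDModule.{u, max u v, w} k (U P))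

/-- A nonzero subspace of a weight module that is stable under the `K_i` contains a weight
vector. -/
theorem exists_weight_vector (hM : IsWeight M) {W : Submodule k M.V} (hW : W ≠ ⊥)
    (hK : ∀ i, ∀ v ∈ W, M.act (K P i) v ∈ W) :
    ∃ v ∈ W, v ≠ 0 ∧ ∃ σ, v ∈ weightSpace M σ := by
  classical
  have key : ∀ (s : Finset (ι → kˣ)) (y : (ι → kˣ) → M.V), (∀ σ, y σ ∈ weightSpace M σ) →
      ∑ σ ∈ s, y σ ∈ W → ∑ σ ∈ s, y σ ≠ 0 → ∃ v ∈ W, v ≠ 0 ∧ ∃ σ, v ∈ weightSpace M σ := by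
    intro s
    induction s using Finset.induction_on with
    | empty => intro y _ _ h; simp at h
    | insert τ s hτ ih =>
      intro y hy hyW hy0
      -- Applying `K_i - τ_i` removes the component of weight `τ`.
      have hdiff : ∀ i, M.act (K P i) (∑ σ ∈ insert τ s, y σ) -
          (τ i : k) • ∑ σ ∈ insert τ s, y σ = ∑ σ ∈ s, ((σ i : k) - τ i) • y σ := by
        intro i
        rw [map_sum, Finset.smul_sum, ← Finset.sum_sub_distrib, Finset.sum_insert hτ, hy τ i,
          sub_self, zero_add]
        exact Finset.sum_congr rfl fun σ _ => by rw [hy σ i, sub_smul]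
      by_cases h : ∀ i, ∑ σ ∈ s, ((σ i : k) - τ i) • y σ = 0
      · refine ⟨_, hyW, hy0, τ, fun i => ?_⟩
        rw [← sub_eq_zero, hdiff, h]
      · push Not at h
        obtain ⟨i, hi⟩ := h
        refine ih (fun σ => ((σ i : k) - τ i) • y σ)
          (fun σ => Submodule.smul_mem _ _ (hy σ)) ?_ hi
        rw [← hdiff]
        exact Submodule.sub_mem _ (hK i _ hyW) (Submodule.smul_mem _ _ hyW)
  obtain ⟨x, hxW, hx0⟩ := Submodule.exists_mem_ne_zero_of_ne_bot hW
  have hx : x ∈ ⨆ σ, weightSpace M σ := by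
    rw [DirectSum.IsInternal.submodule_iSup_eq_top hM]
    exact Submodule.mem_top
  obtain ⟨y, hy, rfl⟩ := (Submodule.mem_iSup_iff_exists_finsupp _ _).mp hx
  exact key y.support y hy hxW hx0

theorem coact_act_K_eq [Fintype ι] {v : M.V} {t : ι → ℤ}
    (hv : M.coact v = v ⊗ₜ (Klam (P := P) t).val) (i : ι) :
    M.coact (M.act (K P i) v) = M.act (K P i) v ⊗ₜ (Klam (P := P) t).val := by
  have h := congrArg (LinearMap.lTensor M.V (LinearMap.mulRight k (Kinv P i)))
    (M.compat (K P i) v)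
  have hid : LinearMap.mulRight k (Kinv P i) ∘ₗ LinearMap.mulRight k (K P i) = LinearMap.id := by
    ext; simp [mul_assoc, K_mul_Kinv]
  rw [comul_K, ydRight_tmul, hv, ydLeft_tmul, ← LinearMap.comp_apply (LinearMap.lTensor _ _),
    ← LinearMap.lTensor_comp, hid, LinearMap.lTensor_id, LinearMap.id_apply,
    LinearMap.lTensor_tmul, LinearMap.mulRight_apply, (commute_K_Klam i t).eq, mul_assoc,
    K_mul_Kinv, mul_one] at h
  exact h.symm

/-- A nonzero weight module contains a weight vector `m` with coaction `m ⊗ K_λ`. -/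
theorem exists_weight_vector_coact [Fintype ι] [Nontrivial M.V] (hM : IsWeight M) :
    ∃ (m : M.V) (σ : ι → kˣ) (t : ι → ℤ), m ≠ 0 ∧ m ∈ weightSpace M σ ∧
      M.coact m = m ⊗ₜ (Klam (P := P) t).val := by
  obtain ⟨x, t, hx, hxt⟩ := exists_coact_eq_Klam M.coassoc M.counit_coact
  let W : Submodule k M.V :=
    LinearMap.ker (M.coact - (TensorProduct.mk k M.V (U P)).flip (Klam (P := P) t).val)
  have hW : ∀ v, v ∈ W ↔ M.coact v = v ⊗ₜ (Klam (P := P) t).val := fun v => by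
    simp [W, sub_eq_zero]
  obtain ⟨m, hmW, hm0, σ, hmσ⟩ := exists_weight_vector M hM (W := W)
    (fun h => hx (by simpa [h] using (hW x).mpr hxt))
    (fun i v hv => (hW _).mpr (coact_act_K_eq M ((hW v).mp hv) i))
  exact ⟨m, σ, t, hm0, hmσ, (hW m).mp hmW⟩

/-- If the Cartan matrix is invertible, there is a linear form on weights which is the same
positive number on all simple roots. -/
theorem exists_height [Fintype ι] [DecidableEq ι] (hdet : P.A.det ≠ 0) :
    ∃ (c : ι → ℤ) (n : ℕ), 0 < n ∧ ∀ j, ∑ i, (P.d j * P.A j i) * c i = n := by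
  -- `A (det A • adj(A) x) = (det A)² x`, used with `x_j = ∏_{l ≠ j} d_l`.
  let x : ι → ℤ := fun j => ∏ l ∈ Finset.univ.erase j, (P.d l : ℤ)
  refine ⟨P.A.det • P.A.adjugate.mulVec x, P.A.det.natAbs ^ 2 * ∏ l, P.d l, ?_, fun j => ?_⟩
  · exact Nat.mul_pos (pow_pos (Int.natAbs_pos.mpr hdet) 2)
      (Finset.prod_pos fun l _ => P.d_pos l)
  · have h1 : P.A.mulVec (P.A.det • P.A.adjugate.mulVec x) = P.A.det ^ 2 • x := by
      rw [Matrix.mulVec_smul, Matrix.mulVec_mulVec, Matrix.mul_adjugate, Matrix.smul_mulVec,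
        Matrix.one_mulVec, smul_smul, sq]
    have h2 := congrFun h1 j
    rw [Matrix.mulVec, dotProduct] at h2
    simp only [mul_assoc]
    rw [← Finset.mul_sum, h2, Pi.smul_apply, smul_eq_mul, mul_left_comm,
      Finset.mul_prod_erase _ (fun l => (P.d l : ℤ)) (Finset.mem_univ j)]
    push_cast
    rw [sq_abs]

/-- The module generated by a weight vector `m` of weight `σ` is `k m` plus a part with weights of
larger height than `σ`, since the `E_i` raise the height. So there is a linear map to
`k_β` that does not kill `m`, where `β(K_i) = σ_i`. -/
theorem exists_linear_to_char [Fintype ι] [DecidableEq ι] (hdet : P.A.det ≠ 0) {m : M.V}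
    {σ : ι → kˣ} (hm0 : m ≠ 0) (hm : m ∈ weightSpace M σ) (hgen : ∀ v, ∃ h, M.act h m = v) :
    ∃ f : Module.Dual k M.V, f m ≠ 0 ∧ ∀ h v, f (M.act h v) = char P σ h * f v := by
  obtain ⟨c, n, hn, hc⟩ := exists_height hdet
  let ht : (ι → kˣ) → kˣ := fun τ => ∏ i, τ i ^ c i
  let Q : kˣ := Units.mk0 P.q P.q_ne_zero ^ n
  have hQ : ∀ l, 0 < l → Q ^ l ≠ 1 := by
    intro l hl h
    rw [← pow_mul] at h
    exact P.q_generic _ (Nat.mul_pos hn hl) (by simpa using congrArg Units.val h)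
  have hshift : ∀ (j : ι) (τ : ι → kˣ),
      ht (fun i => Units.mk0 (P.qi j ^ P.A j i) (zpow_ne_zero _ (qi_ne_zero j)) * τ i) =
        Q * ht τ := by
    intro j τ
    have h1 : ∀ i, Units.mk0 (P.qi j ^ P.A j i) (zpow_ne_zero _ (qi_ne_zero j)) ^ c i =
        Units.mk0 P.q P.q_ne_zero ^ ((P.d j * P.A j i) * c i) := by
      intro i
      ext
      simp [QuantumDatum.qi, zpow_mul]
    simp only [ht, mul_zpow, Finset.prod_mul_distrib, h1]
    have h2 : ∀ (s : Finset ι) (e : ι → ℤ), ∏ i ∈ s, Units.mk0 P.q P.q_ne_zero ^ e i =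
        Units.mk0 P.q P.q_ne_zero ^ ∑ i ∈ s, e i := by
      intro s e
      induction s using Finset.induction_on with
      | empty => simp
      | insert a s ha ih => rw [Finset.prod_insert ha, Finset.sum_insert ha, ih, zpow_add]
    rw [h2, hc, zpow_natCast]
  -- The sum of the weight spaces of larger height.
  let N : Submodule k M.V := ⨆ τ ∈ {τ | ∃ l, 0 < l ∧ ht τ = Q ^ l * ht σ}, weightSpace M τ
  have hNσ : Disjoint (weightSpace M σ) N := by
    refine (iSupIndep_weightSpace M σ).mono_right (biSup_mono fun τ => ?_)
    rintro ⟨l, hl, h⟩ rfl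
    exact hQ l hl (mul_eq_right.mp h.symm)
  have hmN : m ∉ N := fun h => hm0 (Submodule.disjoint_def.mp hNσ m hm h)
  have stable : ∀ (φ : Module.End k M.V), (∀ τ l, 0 < l → ht τ = Q ^ l * ht σ →
      ∀ v ∈ weightSpace M τ, φ v ∈ N) → ∀ v ∈ N, φ v ∈ N := fun φ hφ =>
    (iSup₂_le fun τ ⟨l, hl, h⟩ v hv => hφ τ l hl h v hv : N ≤ N.comap φ)
  have memN : ∀ {τ l}, 0 < l → ht τ = Q ^ l * ht σ → ∀ v ∈ weightSpace M τ, v ∈ N :=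
    fun {τ l} hl h v hv =>
      Submodule.mem_iSup_of_mem τ (Submodule.mem_iSup_of_mem ⟨l, hl, h⟩ hv)
  have hEm : ∀ i, M.act (E P i) m ∈ N := fun i =>
    memN one_pos (by rw [hshift, pow_one]) _ (act_E_mem_weightSpace M i hm)
  have hEN : ∀ i, ∀ v ∈ N, M.act (E P i) v ∈ N := fun i => stable _ fun τ l hl h v hv =>
    memN l.succ_pos (by rw [hshift, h, pow_succ', mul_assoc]) _ (act_E_mem_weightSpace M i hv)
  have hKN : ∀ i, ∀ v ∈ N, M.act (K P i) v ∈ N := fun i => stable _ fun τ l hl h v hv => by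
    rw [hv i]
    exact Submodule.smul_mem _ _ (memN hl h v hv)
  have hKiN : ∀ i, ∀ v ∈ N, M.act (Kinv P i) v ∈ N := fun i => stable _ fun τ l hl h v hv => by
    rw [act_Kinv_of_act_K M (hv i)]
    exact Submodule.smul_mem _ _ (memN hl h v hv)
  obtain ⟨f, hfm, hfN⟩ := Submodule.exists_le_ker_of_notMem hmN
  have hact : ∀ h, (∀ v ∈ N, M.act h v ∈ N) ∧ M.act h m - char P σ h • m ∈ N := by
    intro h
    refine ⟨act_mem_of_generators M hEN hKN hKiN h, ?_⟩
    induction h using induction with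
    | hs c => simp
    | hE i => rw [char_E, zero_smul, sub_zero]; exact hEm i
    | hK i => rw [char_apply_K, hm i, sub_self]; exact N.zero_mem
    | hKinv i =>
      have : char P σ (Kinv P i) = ((σ i)⁻¹ : kˣ) := lift_Kinv (char_sat σ) i
      rw [this, act_Kinv_of_act_K M (hm i), sub_self]; exact N.zero_mem
    | hadd a b ha hb =>
      convert N.add_mem ha hb using 1
      simp only [map_add, LinearMap.add_apply, add_smul]
      abel
    | hmul a b ha hb =>
      convert N.add_mem (act_mem_of_generators M hEN hKN hKiN a _ hb)
        (N.smul_mem (char P σ b) ha) using 1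
      simp only [map_mul, Module.End.mul_apply, map_sub, map_smul, smul_sub, smul_smul]
      rw [mul_comm (char P σ b)]
      abel
  have hf : ∀ h, f (M.act h m) = char P σ h * f m := fun h => by
    have : f (M.act h m - char P σ h • m) = 0 := hfN (hact h).2
    rwa [map_sub, map_smul, smul_eq_mul, sub_eq_zero] at this
  refine ⟨f, hfm, fun h v => ?_⟩
  obtain ⟨a, rfl⟩ := hgen v
  rw [← Module.End.mul_apply, ← map_mul, hf, hf, map_mul, mul_assoc]

end Classification

theorem Phi_bijOn [Fintype ι] [DecidableEq ι] (hdet : P.A.det ≠ 0) :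
    Set.BijOn (Phi : FiniteDualGroupLike k (U P) × GroupLike k (U P) → _) Set.univ
      (simpleWeightClasses P) := by
  refine ⟨fun x _ => ⟨_, isSimple_betaG _ _, isWeight_betaG _ _, rfl⟩,
    Phi_injective.injOn, ?_⟩
  rintro _ ⟨M, hM, hMw, rfl⟩
  have := hM.1
  obtain ⟨m, σ, t, hm0, hmσ, hmt⟩ := exists_weight_vector_coact M hMw
  obtain ⟨f, hfm, hf⟩ := exists_linear_to_char M hdet hm0 hmσ (exists_act_eq hM hm0 hmt)
  exact ⟨(groupLikeChar P σ, Klam t), trivial, Quotient.sound (isomorphic_betaG hM hmt hf hfm)⟩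

end U

end HalfQuantum

end

theorem mainTheorem5 {k : Type*} [Field k] [IsAlgClosed k] [CharZero k]
    {𝔤 : Type*} [LieRing 𝔤] [LieAlgebra k 𝔤] [FiniteDimensional k 𝔤] [LieAlgebra.IsSimple k 𝔤]
    (𝔥 : LieSubalgebra k 𝔤) [𝔥.IsCartanSubalgebra]
    (b : (LieAlgebra.IsKilling.rootSystem 𝔥).Base)
    (P : HalfQuantum.QuantumDatum k b.support)
    (hA : P.A = b.cartanMatrix.transpose)
    (hd : ∀ d' : b.support → ℕ, (∀ i, 0 < d' i) →
      (∀ i j, (d' i : ℤ) * P.A i j = d' j * P.A j i) → ∑ i, P.d i ≤ ∑ i, d' i) :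
    Function.Bijective
      (HalfQuantum.U.weightOf :
        HalfQuantum.FiniteDualGroupLike k (HalfQuantum.U P) → b.support → kˣ) ∧
    Function.Bijective
      (HalfQuantum.U.Klam : (b.support → ℤ) → GroupLike k (HalfQuantum.U P)) ∧
    Set.BijOn
      (HalfQuantum.U.Phi :
        HalfQuantum.FiniteDualGroupLike k (HalfQuantum.U P) × GroupLike k (HalfQuantum.U P) →
          HalfQuantum.YDModule.IsoClass k (HalfQuantum.U P))
      Set.univ (HalfQuantum.U.simpleWeightClasses P) := by
  classical
  have hdet : P.A.det ≠ 0 := by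
    rw [hA, Matrix.det_transpose]
    exact Matrix.nondegenerate_iff_det_ne_zero.mp b.cartanMatrix_nondegenerate
  exact ⟨HalfQuantum.U.weightOf_bijective, HalfQuantum.U.Klam_bijective,
    HalfQuantum.U.Phi_bijOn hdet⟩
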